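/- Let $[n]=\{1,\dots,n\}$ and let $p=p(n)\in[0,1]$ satisfy $p=\omega(1/n)$, i.e. $n\,p(n)\to\infty$ as $n\to\infty$. Let $\mathcal P(n,p)$ be the random family of subsets of $[n]$ that contains each $F\subseteq[n]$ with probability $p$, independently of all other sets. For a finite poset $P$, a family $\mathcal G$ of subsets of $[n]$ is an induced copy of $P$ if there is a bijection $i:P\to\mathcal G$ such that $x\le y$ if and only if $i(x)\subseteq i(y)$ for all $x,y\in P$; a family is induced $P$-free if no subfamily of it is an induced copy of $P$. The complete multipartite poset $K_{r_1,\dots,r_\ell}$ has elements $a_{i,j}$ ($1\le i\le \ell$, $1\le j\le r_i$) with $a_{i,j}<a_{i',j'}$ if and only if $i<i'$, and $\vee_r=K_{1,r}$. An event holds with high probability if its probability tends to $1$ as $n\to\infty$. Then the following are true. (i) For every fixed integer $r\ge 0$, with high probability the largest induced $\vee_{r+1}$-free family contained in $\mathcal P(n,p)$ has size $(1+o(1))\,p\binom{n}{\lfloor n/2\rfloor}$. (ii) For every fixed pair of integers $s,t\ge 1$, with high probability the largest induced $K_{s,1,t}$-free family contained in $\mathcal P(n,p)$ has size $(2+o(1))\,p\binom{n}{\lfloor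 n/2\rfloor}$. Here "with high probability $X_n$ has size $(c+o(1))\,p\binom{n}{\lfloor n/2\rfloor}$" means that for every $\varepsilon>0$ the probability that $(c-\varepsilon)\,p\binom{n}{\lfloor n/2\rfloor}\le X_n\le (c+\varepsilon)\,p\binom{n}{\lfloor n/2\rfloor}$ tends to $1$ as $n\to\infty$. -/

import Mathlib

open Filter Asymptotics

/-- Underlying set of the complete multipartite poset `K_{r 0, …, r (ℓ - 1)}`: the elements
`a_{i,j}` with `i : Fin ℓ` and `j : Fin (r i)`. -/
def CompleteMultipartite {ℓ : ℕ} (r : Fin ℓ → ℕ) : Type :=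
  (i : Fin ℓ) × Fin (r i)

/-- `a_{i,j} < a_{i',j'}` if and only if `i < i'`. -/
instance CompleteMultipartite.instPartialOrder {ℓ : ℕ} (r : Fin ℓ → ℕ) :
    PartialOrder (CompleteMultipartite r) where
  lt x y := x.1 < y.1
  le x y := x = y ∨ x.1 < y.1
  le_refl _ := Or.inl rfl
  le_trans x y z := by
    rintro (rfl | h) (rfl | h')
    · exact Or.inl rfl
    · exact Or.inr h'
    · exact Or.inr h
    · exact Or.inr (lt_trans h h')
  le_antisymm x y := by
    rintro (rfl | h) (h' | h')
    · rfl
    · rfl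
    · exact h'.symm
    · exact absurd h' (lt_asymm h)
  lt_iff_le_not_ge x y := by
    constructor
    · intro h
      refine ⟨Or.inr h, ?_⟩
      rintro (rfl | h')
      · exact lt_irrefl _ h
      · exact lt_asymm h h'
    · rintro ⟨rfl | h, h'⟩
      · exact absurd (Or.inl rfl) h'
      · exact h

/-- The poset `∨_r = K_{1,r}`. -/
abbrev VeePoset (r : ℕ) : Type := CompleteMultipartite ![1, r]

/-- The poset `K_{s,1,t}`. -/
abbrev KPoset (s t : ℕ) : Type := CompleteMultipartite ![s, 1, t]

/-- The family `G` of subsets of `[n]`, ordered by inclusion, is an induced copy of `P`: there is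
a bijection `i : P → G` with `p ≤ q ↔ i p ⊆ i q`. -/
def IsInducedCopy {n : ℕ} (P : Type) [PartialOrder P] (G : Set (Finset (Fin n))) : Prop :=
  ∃ i : P ≃ G, ∀ p q : P, p ≤ q ↔ (i p : Finset (Fin n)) ⊆ (i q : Finset (Fin n))

/-- `F` contains no induced copy of `P`. -/
def IsInducedFree {n : ℕ} (P : Type) [PartialOrder P] (F : Set (Finset (Fin n))) : Prop :=
  ∀ G : Set (Finset (Fin n)), G ⊆ F → ¬ IsInducedCopy P G

/-- The size of the largest induced `P`-free subfamily of `S`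
(a genuine maximum for nonempty `P`, see `largestInducedFree_isGreatest`). -/
noncomputable def largestInducedFree {n : ℕ} (P : Type) [PartialOrder P]
    (S : Set (Finset (Fin n))) : ℕ :=
  sSup {k : ℕ | ∃ F : Set (Finset (Fin n)), F ⊆ S ∧ IsInducedFree P F ∧ F.ncard = k}

theorem largestInducedFree_isGreatest {n : ℕ} (P : Type) [PartialOrder P] [Nonempty P]
    (S : Set (Finset (Fin n))) :
    IsGreatest {k : ℕ | ∃ F : Set (Finset (Fin n)), F ⊆ S ∧ IsInducedFree P F ∧ F.ncard = k}
      (largestInducedFree P S) := by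
  have hne : {k : ℕ | ∃ F : Set (Finset (Fin n)),
      F ⊆ S ∧ IsInducedFree P F ∧ F.ncard = k}.Nonempty := by
    refine ⟨0, ∅, Set.empty_subset _, ?_, Set.ncard_empty _⟩
    rintro G hG ⟨i, -⟩
    obtain ⟨x⟩ := ‹Nonempty P›
    exact hG (i x).2
  have hb : BddAbove {k : ℕ | ∃ F : Set (Finset (Fin n)),
      F ⊆ S ∧ IsInducedFree P F ∧ F.ncard = k} := by
    refine ⟨S.ncard, ?_⟩
    rintro k ⟨F, hF, -, rfl⟩
    exact Set.ncard_le_ncard hF (Set.toFinite S)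
  exact ⟨Nat.sSup_mem hne hb, fun k hk => le_csSup hb hk⟩

/-- The law of the random family `𝒫(n,p)`: each `F ⊆ [n]` belongs to it with probability `p`,
independently of all other sets. -/
noncomputable def randomFamily (n : ℕ) (p : unitInterval) :
    MeasureTheory.Measure (Set (Finset (Fin n))) :=
  ProbabilityTheory.setBernoulli Set.univ p

/-- With high probability, the largest induced `P`-free family in `𝒫(n, p n)` has size
`(c + o(1)) p n * (n choose ⌊n/2⌋)`, as `n → ∞`. -/
def LargestInducedFreeAsymp (P : Type) [PartialOrder P] (p : ℕ → unitInterval) (c : ℝ) : Prop :=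
  ∀ ε : ℝ, 0 < ε →
    Tendsto (fun n : ℕ => (randomFamily n (p n)).real
      {S | (c - ε) * ((p n : ℝ) * (n.choose (n / 2) : ℝ)) ≤ (largestInducedFree P S : ℝ) ∧
        (largestInducedFree P S : ℝ) ≤ (c + ε) * ((p n : ℝ) * (n.choose (n / 2) : ℝ))})
      atTop (nhds 1)

/-! The lower bounds come from one middle level, or two consecutive ones: these contain no chain of
two, respectively three, sets, and a Chernoff bound controls how many of their members are selected.

For the upper bounds, the exponential moment E(C) of the largest `VeeFree r` subfamily of a random
subset of C (`expMaxCard`) is bounded recursively. If a set U of d members of C lies above A on a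
single level, a vee-free family through A keeps at most r of them, so E(C) ≤ E(C - A) + p e^(l(r+1))
E(C - A - U). Such a vertex therefore costs only a factor x with 1 + p e^(l(r+1)) / x^d ≤ x
(`expMaxCard_le_mul_pow`). The recursion stops at families of small Lubell function, where the
trivial bound exp(p(e^l - 1)|C|) is good enough.

Suitable A exist by supersaturation (`exists_large_upper_level`): a large Lubell function forces
many comparable pairs on a random maximal chain. This is used twice. Down to Lubell value 4, pairs
with size gap at least 3 give d of order n^3, so x = e^(pη/(n+1)) is allowed and is affordable for
all 2^n ≤ (n+1) `middle n` sets. From 4 down to 1 + ε, d has order n and x = e^(pη) is paid at most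
4 `middle n` times; here pn → ∞ is essential.

For K_{s,1,t}, a member with a t-antichain above it has no s-antichain below it. The family thus
splits into a vee-free part and a part whose image under complementation is vee-free, and the random
family has the same law after complementation. -/

/-! ### Expectation over a p-random subset. -/

section BiasedSum

variable {α : Type*}

/-- The expectation of `f S`, where `S` is a `p`-random subset of `C`. -/
noncomputable def biasedSum (p : ℝ) (C : Finset α) (f : Finset α → ℝ) : ℝ :=
  ∑ S ∈ C.powerset, p ^ S.card * (1 - p) ^ (C.card - S.card) * f S

theorem biasedSum_empty (p : ℝ) (f : Finset α → ℝ) : biasedSum p ∅ f = f ∅ := by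
  simp [biasedSum]

theorem biasedSum_insert [DecidableEq α] (p : ℝ) {C : Finset α} {v : α} (hv : v ∉ C) (f : Finset α → ℝ) :
    biasedSum p (insert v C) f =
      (1 - p) * biasedSum p C f + p * biasedSum p C (fun S => f (insert v S)) := by
  unfold biasedSum
  rw [Finset.sum_powerset_insert hv, Finset.mul_sum, Finset.mul_sum]
  congr 1
  · refine Finset.sum_congr rfl fun S hS => ?_
    have hSC := Finset.card_le_card (Finset.mem_powerset.1 hS)
    rw [Finset.card_insert_of_notMem hv, Nat.sub_add_comm hSC, pow_succ]
    ring
  · refine Finset.sum_congr rfl fun S hS => ?_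
    have hvS : v ∉ S := fun h => hv (Finset.mem_powerset.1 hS h)
    rw [Finset.card_insert_of_notMem hv, Finset.card_insert_of_notMem hvS, Nat.add_sub_add_right,
      pow_succ]
    ring

theorem biasedSum_mono {p : ℝ} (hp0 : 0 ≤ p) (hp1 : p ≤ 1) {C : Finset α} {f g : Finset α → ℝ}
    (h : ∀ S ⊆ C, f S ≤ g S) : biasedSum p C f ≤ biasedSum p C g := by
  refine Finset.sum_le_sum fun S hS => ?_
  have : 0 ≤ 1 - p := by linarith
  exact mul_le_mul_of_nonneg_left (h S (Finset.mem_powerset.1 hS)) (by positivity)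

theorem biasedSum_add (p : ℝ) (C : Finset α) (f g : Finset α → ℝ) :
    biasedSum p C (fun S => f S + g S) = biasedSum p C f + biasedSum p C g := by
  simp [biasedSum, mul_add, Finset.sum_add_distrib]

theorem biasedSum_const_mul (p : ℝ) (C : Finset α) (c : ℝ) (f : Finset α → ℝ) :
    biasedSum p C (fun S => c * f S) = c * biasedSum p C f := by
  simp only [biasedSum, Finset.mul_sum]
  exact Finset.sum_congr rfl fun S _ => by ring

theorem biasedSum_nonneg {p : ℝ} (hp0 : 0 ≤ p) (hp1 : p ≤ 1) {C : Finset α} {f : Finset α → ℝ}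
    (h : ∀ S, 0 ≤ f S) : 0 ≤ biasedSum p C f := by
  refine Finset.sum_nonneg fun S _ => ?_
  have : 0 ≤ 1 - p := by linarith
  have := h S
  positivity

/-- Elements of `U` do not influence `f (S \ U)`, and their weights `1 - p` and `p` sum to one. -/
theorem biasedSum_sdiff [DecidableEq α] (p : ℝ) (U : Finset α) (C : Finset α) (f : Finset α → ℝ) :
    biasedSum p C (fun S => f (S \ U)) = biasedSum p (C \ U) f := by
  induction C using Finset.induction_on generalizing f with
  | empty => simp [biasedSum_empty]
  | insert v C hv ih =>
    rw [biasedSum_insert p hv]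
    by_cases hU : v ∈ U
    · simp only [Finset.insert_sdiff_of_mem _ hU, ih]
      ring
    · simp only [Finset.insert_sdiff_of_notMem _ hU, ih]
      rw [ih (fun S => f (insert v S)), biasedSum_insert p (by simp [hv])]

/-- By independence, each element of `C ∩ D` contributes a factor `(1 - p) + p * z` and every other
element a factor one. -/
theorem biasedSum_pow_card_inter [DecidableEq α] (p z : ℝ) (D : Finset α) (C : Finset α) :
    biasedSum p C (fun S => z ^ (S ∩ D).card) = (1 + p * (z - 1)) ^ (C ∩ D).card := by
  induction C using Finset.induction_on with
  | empty => simp [biasedSum_empty]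
  | insert v C hv ih =>
    rw [biasedSum_insert p hv, ih]
    by_cases hD : v ∈ D
    · have h1 : biasedSum p C (fun S => z ^ (insert v S ∩ D).card)
          = biasedSum p C (fun S => z * z ^ (S ∩ D).card) := by
        refine Finset.sum_congr rfl fun S hS => ?_
        have hvS : v ∉ S := fun h => hv (Finset.mem_powerset.1 hS h)
        beta_reduce
        rw [Finset.insert_inter_of_mem hD, Finset.card_insert_of_notMem (by simp [hvS]), pow_succ]
        ring
      rw [h1, biasedSum_const_mul, ih, Finset.insert_inter_of_mem hD,
        Finset.card_insert_of_notMem (by simp [hv]), pow_succ]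
      ring
    · simp only [Finset.insert_inter_of_notMem hD, ih]
      ring

theorem biasedSum_map_equiv [Fintype α] (p : ℝ) (e : α ≃ α) (f : Finset α → ℝ) :
    biasedSum p Finset.univ (fun S => f (S.map e.toEmbedding)) = biasedSum p Finset.univ f := by
  unfold biasedSum
  simp only [Finset.powerset_univ]
  exact Fintype.sum_equiv e.finsetCongr _ _ fun S => by simp

end BiasedSum

/-- An exponential-moment bound for events of the random family. -/
theorem randomFamily_real_le {n : ℕ} (p : unitInterval) (A : Set (Set (Finset (Fin n))))
    (f : Finset (Finset (Fin n)) → ℝ) (hf : ∀ S, 0 ≤ f S)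
    (h : ∀ S : Finset (Finset (Fin n)), (S : Set (Finset (Fin n))) ∈ A → 1 ≤ f S) :
    (randomFamily n p).real A ≤ biasedSum p Finset.univ f := by
  classical
  have hA : A = ⋃ S ∈ (Finset.univ.filter fun S : Finset (Finset (Fin n)) =>
      (S : Set (Finset (Fin n))) ∈ A), {(S : Set (Finset (Fin n)))} := by
    ext X
    simp only [Finset.mem_filter, Finset.mem_univ, true_and, Set.mem_iUnion, exists_prop,
      Set.mem_singleton_iff]
    constructor
    · intro hX
      exact ⟨X.toFinite.toFinset, by simpa using hX, by simp⟩
    · rintro ⟨S, hS, rfl⟩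
      exact hS
  have hp0 : (0 : ℝ) ≤ p := p.2.1
  have hp1 : (0 : ℝ) ≤ 1 - p := by linarith [p.2.2]
  calc (randomFamily n p).real A
      ≤ ∑ S ∈ (Finset.univ.filter fun S : Finset (Finset (Fin n)) =>
        (S : Set (Finset (Fin n))) ∈ A), (randomFamily n p).real {(S : Set (Finset (Fin n)))} := by
        conv_lhs => rw [hA]
        exact MeasureTheory.measureReal_biUnion_finset_le _ _
    _ ≤ ∑ S ∈ (Finset.univ.filter fun S : Finset (Finset (Fin n)) =>
        (S : Set (Finset (Fin n))) ∈ A), (p : ℝ) ^ S.card *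
          (1 - p) ^ ((Finset.univ : Finset (Finset (Fin n))).card - S.card) * f S := by
        refine Finset.sum_le_sum fun S hS => ?_
        rw [randomFamily, ProbabilityTheory.setBernoulli_real_singleton p (Set.subset_univ _)
          Set.finite_univ, Set.ncard_coe_finset, ← Finset.coe_univ, ← Finset.coe_sdiff,
          Set.ncard_coe_finset, Finset.card_sdiff_of_subset (Finset.subset_univ _)]
        exact le_mul_of_one_le_right (by positivity) (h S (Finset.mem_filter.1 hS).2)
    _ ≤ biasedSum p Finset.univ f := by
        unfold biasedSum
        refine Finset.sum_le_sum_of_subset_of_nonneg (fun S _ => by simp) fun S _ _ => ?_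
        have := hf S
        positivity

/-! ### The largest admissible subset and its exponential moment. -/

section MaxCard

variable {α : Type*}

open Classical in
/-- The largest size of a subset of `S` that satisfies `Q`. -/
noncomputable def maxCard (Q : Finset α → Prop) (S : Finset α) : ℕ :=
  (S.powerset.filter Q).sup Finset.card

theorem card_le_maxCard {Q : Finset α → Prop} {S I : Finset α} (hI : Q I) (h : I ⊆ S) :
    I.card ≤ maxCard Q S := by
  classical
  exact Finset.le_sup (f := Finset.card) (Finset.mem_filter.2 ⟨Finset.mem_powerset.2 h, hI⟩)

theorem maxCard_le {Q : Finset α → Prop} {S : Finset α} {k : ℕ}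
    (h : ∀ I ⊆ S, Q I → I.card ≤ k) : maxCard Q S ≤ k := by
  classical
  refine Finset.sup_le fun I hI => ?_
  rw [Finset.mem_filter, Finset.mem_powerset] at hI
  exact h I hI.1 hI.2

theorem maxCard_insert_le_succ [DecidableEq α] {Q : Finset α → Prop} (hQ : ∀ I J, J ⊆ I → Q I → Q J)
    (S : Finset α) (v : α) : maxCard Q (insert v S) ≤ maxCard Q S + 1 := by
  refine maxCard_le fun I hI hQI => ?_
  have h1 := card_le_maxCard (S := S) (hQ I (I.erase v) (Finset.erase_subset _ _) hQI)
    (by rwa [← Finset.subset_insert_iff])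
  have := Finset.pred_card_le_card_erase (s := I) (a := v)
  omega

/-- An admissible set avoids `v`, or it contains `v` and loses at most `r + 1` elements when `v` and
its part in `U` are removed. -/
theorem maxCard_insert_le_max [DecidableEq α] {Q : Finset α → Prop} (hQ : ∀ I J, J ⊆ I → Q I → Q J)
    {r : ℕ} {v : α} {U : Finset α} (hU : ∀ I, Q I → v ∈ I → (I ∩ U).card ≤ r) (S : Finset α) :
    maxCard Q (insert v S) ≤ max (maxCard Q S) (maxCard Q (S \ U) + (r + 1)) := by
  refine maxCard_le fun I hI hQI => ?_
  by_cases hv : v ∈ I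
  · refine le_max_of_le_right ?_
    have h1 : ((I.erase v) \ U).card ≤ maxCard Q (S \ U) :=
      card_le_maxCard (hQ I _ (Finset.sdiff_subset.trans (Finset.erase_subset _ _)) hQI)
        (Finset.sdiff_subset_sdiff (by rwa [← Finset.subset_insert_iff]) le_rfl)
    have h2 : (I.erase v ∩ U).card ≤ r :=
      (Finset.card_le_card (Finset.inter_subset_inter_right (Finset.erase_subset _ _))).trans
        (hU I hQI hv)
    have h3 := Finset.card_sdiff_add_card_inter (I.erase v) U
    have h4 := Finset.card_erase_of_mem hv
    omega
  · refine le_max_of_le_left (card_le_maxCard hQI ?_)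
    rwa [← Finset.erase_eq_of_notMem hv, ← Finset.subset_insert_iff]

/-- The exponential moment of the largest `Q`-subset of a `p`-random subset of `C`. -/
noncomputable def expMaxCard (Q : Finset α → Prop) (p l : ℝ) (C : Finset α) : ℝ :=
  biasedSum p C fun S => Real.exp (l * maxCard Q S)

theorem expMaxCard_nonneg (Q : Finset α → Prop) {p : ℝ} (hp0 : 0 ≤ p) (hp1 : p ≤ 1) (l : ℝ)
    (C : Finset α) : 0 ≤ expMaxCard Q p l C :=
  biasedSum_nonneg hp0 hp1 fun _ => (Real.exp_pos _).le

theorem expMaxCard_empty (Q : Finset α → Prop) (p l : ℝ) : expMaxCard Q p l ∅ = 1 := by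
  have : maxCard Q ∅ = 0 := Nat.le_zero.1 (maxCard_le fun I hI _ => by
    simp [Finset.subset_empty.1 hI])
  simp [expMaxCard, biasedSum_empty, this]

/-- A new element is selected with probability `p` and then raises the maximum by at most one, which
gives the factor `1 + p * (exp l - 1)`. -/
theorem expMaxCard_insert_le [DecidableEq α] {Q : Finset α → Prop} (hQ : ∀ I J, J ⊆ I → Q I → Q J)
    {p l : ℝ} (hp0 : 0 ≤ p) (hp1 : p ≤ 1) (hl : 0 ≤ l) (v : α) (C : Finset α) :
    expMaxCard Q p l (insert v C) ≤ Real.exp (p * (Real.exp l - 1)) * expMaxCard Q p l C := by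
  have hG := expMaxCard_nonneg Q hp0 hp1 l C
  have hl1 : 0 ≤ Real.exp l - 1 := by linarith [Real.add_one_le_exp l]
  by_cases hv : v ∈ C
  · rw [Finset.insert_eq_of_mem hv]
    refine le_mul_of_one_le_left hG (Real.one_le_exp (by positivity))
  have h1 : biasedSum p C (fun S => Real.exp (l * maxCard Q (insert v S)))
      ≤ Real.exp l * expMaxCard Q p l C := by
    rw [expMaxCard, ← biasedSum_const_mul]
    refine biasedSum_mono hp0 hp1 fun S _ => ?_
    rw [← Real.exp_add, Real.exp_le_exp]
    have : (maxCard Q (insert v S) : ℝ) ≤ maxCard Q S + 1 := by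
      exact_mod_cast maxCard_insert_le_succ hQ S v
    nlinarith
  have h2 : 1 + p * (Real.exp l - 1) ≤ Real.exp (p * (Real.exp l - 1)) := by
    linarith [Real.add_one_le_exp (p * (Real.exp l - 1))]
  calc expMaxCard Q p l (insert v C)
      = (1 - p) * expMaxCard Q p l C
        + p * biasedSum p C (fun S => Real.exp (l * maxCard Q (insert v S))) := by
        rw [expMaxCard, biasedSum_insert p hv]; rfl
    _ ≤ (1 - p) * expMaxCard Q p l C + p * (Real.exp l * expMaxCard Q p l C) := by gcongr
    _ = (1 + p * (Real.exp l - 1)) * expMaxCard Q p l C := by ring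
    _ ≤ _ := by gcongr

theorem expMaxCard_union_le [DecidableEq α] {Q : Finset α → Prop} (hQ : ∀ I J, J ⊆ I → Q I → Q J)
    {p l : ℝ} (hp0 : 0 ≤ p) (hp1 : p ≤ 1) (hl : 0 ≤ l) (D C : Finset α) :
    expMaxCard Q p l (D ∪ C) ≤ Real.exp (p * (Real.exp l - 1) * D.card) * expMaxCard Q p l C := by
  induction D using Finset.induction_on with
  | empty => simp
  | insert v D hv ih =>
    rw [Finset.insert_union, Finset.card_insert_of_notMem hv]
    refine (expMaxCard_insert_le hQ hp0 hp1 hl v _).trans ?_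
    refine (mul_le_mul_of_nonneg_left ih (Real.exp_pos _).le).trans_eq ?_
    rw [← mul_assoc, ← Real.exp_add]
    push_cast
    ring_nf

theorem expMaxCard_le_exp_card [DecidableEq α] {Q : Finset α → Prop} (hQ : ∀ I J, J ⊆ I → Q I → Q J)
    {p l : ℝ} (hp0 : 0 ≤ p) (hp1 : p ≤ 1) (hl : 0 ≤ l) (C : Finset α) :
    expMaxCard Q p l C ≤ Real.exp (p * (Real.exp l - 1) * C.card) := by
  simpa [expMaxCard_empty] using expMaxCard_union_le hQ hp0 hp1 hl C ∅

/-- The exponential of a maximum is at most the sum of the exponentials. The term without `v` occurs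
with weights `1 - p` and `p`, which recombine, so only the term with `U` deleted carries the extra
factor `p * exp (l * (r + 1))`. -/
theorem expMaxCard_insert_le_add [DecidableEq α] {Q : Finset α → Prop} (hQ : ∀ I J, J ⊆ I → Q I → Q J)
    {p l : ℝ} (hp0 : 0 ≤ p) (hp1 : p ≤ 1) (hl : 0 ≤ l) {r : ℕ} {v : α} {U C : Finset α}
    (hv : v ∉ C) (hU : ∀ I, Q I → v ∈ I → (I ∩ U).card ≤ r) :
    expMaxCard Q p l (insert v C) ≤
      expMaxCard Q p l C + p * Real.exp (l * (r + 1)) * expMaxCard Q p l (C \ U) := by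
  have h1 : biasedSum p C (fun S => Real.exp (l * maxCard Q (insert v S)))
      ≤ expMaxCard Q p l C + Real.exp (l * (r + 1)) * expMaxCard Q p l (C \ U) := by
    rw [expMaxCard, expMaxCard, ← biasedSum_sdiff, ← biasedSum_const_mul, ← biasedSum_add]
    refine biasedSum_mono hp0 hp1 fun S _ => ?_
    rw [← Real.exp_add]
    rcases le_max_iff.1 (maxCard_insert_le_max hQ hU S) with h | h
    · have h' : (maxCard Q (insert v S) : ℝ) ≤ maxCard Q S := by exact_mod_cast h
      have : Real.exp (l * maxCard Q (insert v S)) ≤ Real.exp (l * maxCard Q S) :=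
        Real.exp_le_exp.2 (by gcongr)
      linarith [Real.exp_pos (l * (r + 1) + l * maxCard Q (S \ U))]
    · have h' : (maxCard Q (insert v S) : ℝ) ≤ maxCard Q (S \ U) + (r + 1) := by exact_mod_cast h
      have : Real.exp (l * maxCard Q (insert v S)) ≤
          Real.exp (l * (r + 1) + l * maxCard Q (S \ U)) :=
        Real.exp_le_exp.2 (by rw [← mul_add, add_comm]; gcongr)
      linarith [Real.exp_pos (l * maxCard Q S)]
  calc expMaxCard Q p l (insert v C)
      = (1 - p) * expMaxCard Q p l C
        + p * biasedSum p C (fun S => Real.exp (l * maxCard Q (insert v S))) := by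
        rw [expMaxCard, biasedSum_insert p hv]; rfl
    _ ≤ (1 - p) * expMaxCard Q p l C + p * (expMaxCard Q p l C
        + Real.exp (l * (r + 1)) * expMaxCard Q p l (C \ U)) := by gcongr
    _ = _ := by ring

/-- If every subset of `M` that is not small has a vertex `v` such that the `Q`-sets through `v`
have at most `r` elements in a set of size `d`, then the exponential moment grows by a factor of at
most `x` per vertex. -/
theorem expMaxCard_le_mul_pow [DecidableEq α] {Q : Finset α → Prop} (hQ : ∀ I J, J ⊆ I → Q I → Q J)
    {p l : ℝ} (hp0 : 0 ≤ p) (hp1 : p ≤ 1) (hl : 0 ≤ l) {r d : ℕ} {x B : ℝ} (hx1 : 1 ≤ x)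
    (hB : 0 ≤ B) (hx : 1 + p * Real.exp (l * (r + 1)) / x ^ d ≤ x)
    (Small : Finset α → Prop) {M : Finset α}
    (hsmall : ∀ C ⊆ M, Small C → expMaxCard Q p l C ≤ B)
    (hstep : ∀ C ⊆ M, ¬ Small C → ∃ v ∈ C, ∃ U ⊆ C, v ∉ U ∧ d ≤ U.card ∧
      ∀ I, Q I → v ∈ I → (I ∩ U).card ≤ r) (C : Finset α) (hC : C ⊆ M) :
    expMaxCard Q p l C ≤ B * x ^ C.card := by
  induction C using Finset.strongInduction with
  | H C ih =>
  by_cases hs : Small C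
  · exact (hsmall C hC hs).trans (le_mul_of_one_le_right hB (one_le_pow₀ hx1))
  obtain ⟨v, hv, U, hUC, hvU, hd, hU⟩ := hstep C hC hs
  have hx0 : 0 < x := by linarith
  have hE : C.erase v ⊂ C := Finset.erase_ssubset hv
  have h1 := ih _ hE (hE.subset.trans hC)
  have h2 := ih (C.erase v \ U) (Finset.ssubset_of_subset_of_ssubset Finset.sdiff_subset hE)
    (Finset.sdiff_subset.trans (hE.subset.trans hC))
  have hUE : U ⊆ C.erase v := fun u hu =>
    Finset.mem_erase.2 ⟨fun h => hvU (h ▸ hu), hUC hu⟩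
  have hcard : (C.erase v \ U).card + d ≤ (C.erase v).card := by
    rw [Finset.card_sdiff_of_subset hUE]
    have := Finset.card_le_card hUE
    omega
  -- Deleting `U` gains a factor `x ^ d`, which is what offsets `p * exp (l * (r + 1))`.
  have h3 : x ^ (C.erase v \ U).card ≤ x ^ (C.erase v).card / x ^ d := by
    rw [le_div_iff₀ (by positivity), ← pow_add]
    exact pow_le_pow_right₀ hx1 hcard
  have hrec := expMaxCard_insert_le_add hQ hp0 hp1 hl (Finset.notMem_erase v C) hU
  rw [Finset.insert_erase hv] at hrec
  have hCc : C.card = (C.erase v).card + 1 := (Finset.card_erase_add_one hv).symm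
  calc expMaxCard Q p l C
      ≤ B * x ^ (C.erase v).card + p * Real.exp (l * (r + 1)) *
          (B * (x ^ (C.erase v).card / x ^ d)) := by
        refine hrec.trans (add_le_add h1 ?_)
        gcongr
        exact h2.trans (by gcongr)
    _ = B * x ^ (C.erase v).card * (1 + p * Real.exp (l * (r + 1)) / x ^ d) := by ring
    _ ≤ B * x ^ (C.erase v).card * x := by gcongr
    _ = B * x ^ C.card := by rw [hCc, pow_succ]; ring

end MaxCard

/-! ### Lubell function and supersaturation. -/

section Lubell

variable {ι : Type*} [DecidableEq ι]

/-- The reciprocal binomial coefficient is the probability that a uniform maximal chain of subsets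
of `X` passes through `B`. The identity conditions on the member of the chain just below `X`. -/
theorem sum_ssubset_inv_choose (X : Finset ι) (C : Finset (Finset ι))
    (g : Finset ι → ℝ) :
    X.card * ∑ B ∈ C with B ⊂ X, g B / X.card.choose B.card =
      ∑ x ∈ X, ∑ B ∈ C with B ⊆ X.erase x, g B / (X.card - 1).choose B.card := by
  have h1 : ∀ x ∈ X, (C.filter fun B => B ⊆ X.erase x) =
      (C.filter fun B => B ⊂ X).filter fun B => x ∉ B := by
    intro x hx
    ext B
    simp only [Finset.mem_filter, Finset.subset_erase, and_assoc, Finset.ssubset_iff_subset_ne]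
    constructor
    · rintro ⟨h, h', h''⟩
      exact ⟨h, h', fun e => h'' (e ▸ hx), h''⟩
    · rintro ⟨h, h', -, h''⟩
      exact ⟨h, h', h''⟩
  have h1' : ∀ x ∈ X, ∑ B ∈ C with B ⊆ X.erase x, g B / ((X.card - 1).choose B.card : ℝ) =
      ∑ B ∈ C with B ⊂ X, if x ∉ B then g B / ((X.card - 1).choose B.card : ℝ) else 0 := by
    intro x hx
    rw [h1 x hx, Finset.sum_filter]
  rw [Finset.sum_congr rfl h1', Finset.sum_comm, Finset.mul_sum]
  refine Finset.sum_congr rfl fun B hB => ?_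
  have hBX := (Finset.mem_filter.1 hB).2
  have hlt := Finset.card_lt_card hBX
  rw [← Finset.sum_filter, Finset.sum_const, ← Finset.sdiff_eq_filter,
    Finset.card_sdiff_of_subset hBX.subset, nsmul_eq_mul]
  obtain ⟨N, hN⟩ : ∃ N, X.card = N + 1 := ⟨X.card - 1, by omega⟩
  rw [hN] at hlt ⊢
  have h2 := Nat.choose_mul_succ_eq N B.card
  have h3 : (0 : ℝ) < N.choose B.card := by
    exact_mod_cast Nat.choose_pos (by omega)
  have h4 : (0 : ℝ) < (N + 1).choose B.card := by
    exact_mod_cast Nat.choose_pos (by omega)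
  have h5 : (N.choose B.card : ℝ) * (N + 1 : ℕ) = (N + 1).choose B.card * (N + 1 - B.card : ℕ) := by
    exact_mod_cast h2
  rw [Nat.add_sub_cancel]
  field_simp
  linear_combination g B * h5

theorem sum_level_inv_choose_le_one (X : Finset ι) (C : Finset (Finset ι)) (j : ℕ) :
    ∑ B ∈ C with B ⊆ X ∧ B.card = j, (1 : ℝ) / X.card.choose B.card ≤ 1 := by
  have h1 : (C.filter fun B => B ⊆ X ∧ B.card = j) ⊆ X.powersetCard j := by
    intro B hB
    rw [Finset.mem_powersetCard]
    exact (Finset.mem_filter.1 hB).2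
  calc ∑ B ∈ C with B ⊆ X ∧ B.card = j, (1 : ℝ) / X.card.choose B.card
      = ∑ B ∈ C with B ⊆ X ∧ B.card = j, (1 : ℝ) / X.card.choose j :=
        Finset.sum_congr rfl fun B hB => by rw [(Finset.mem_filter.1 hB).2.2]
    _ ≤ ∑ B ∈ X.powersetCard j, (1 : ℝ) / X.card.choose j :=
        Finset.sum_le_sum_of_subset_of_nonneg h1 fun _ _ _ => by positivity
    _ ≤ 1 := by
        rw [Finset.sum_const, Finset.card_powersetCard, nsmul_eq_mul, mul_one_div]
        exact div_self_le_one _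

/-- Only the `k - 1` levels immediately below `X` occur, and each is met once by a chain. -/
theorem sum_high_levels_inv_choose_le (X : Finset ι) (C : Finset (Finset ι)) (k : ℕ) :
    ∑ B ∈ C with B ⊂ X ∧ X.card < B.card + k, (1 : ℝ) / X.card.choose B.card ≤ (k - 1 : ℕ) := by
  have hmap : ∀ B ∈ C.filter fun B => B ⊂ X ∧ X.card < B.card + k,
      X.card - B.card ∈ Finset.Ico 1 k := by
    intro B hB
    obtain ⟨-, h1, h2⟩ := Finset.mem_filter.1 hB
    have := Finset.card_lt_card h1
    rw [Finset.mem_Ico]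
    omega
  rw [← Finset.sum_fiberwise_of_maps_to hmap]
  calc _ ≤ ∑ i ∈ Finset.Ico 1 k, (1 : ℝ) := by
        refine Finset.sum_le_sum fun i _ => ?_
        refine le_trans ?_ (sum_level_inv_choose_le_one X C (X.card - i))
        refine Finset.sum_le_sum_of_subset_of_nonneg (fun B hB => ?_) fun _ _ _ => by positivity
        simp only [Finset.mem_filter] at hB ⊢
        have := Finset.card_lt_card hB.1.2.1
        exact ⟨hB.1.1, hB.1.2.1.subset, by omega⟩
    _ = (k - 1 : ℕ) := by simp

/-- Averaged over the maximal chains of `X`, a family has at most `k` more members on a chain than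
pairs of members on it whose sizes differ by at least `k`. -/
theorem sum_one_sub_pairs_le (C : Finset (Finset ι)) {k : ℕ} (hk : 1 ≤ k)
    (X : Finset ι) :
    ∑ B ∈ C with B ⊆ X, (1 - ∑ A ∈ C with A ⊂ B ∧ A.card + k ≤ B.card,
      (1 : ℝ) / B.card.choose A.card) / X.card.choose B.card ≤ k := by
  set s : Finset ι → ℝ := fun B => ∑ A ∈ C with A ⊂ B ∧ A.card + k ≤ B.card,
      (1 : ℝ) / B.card.choose A.card with hs
  have hs0 : ∀ B, 0 ≤ s B := fun B => Finset.sum_nonneg fun _ _ => by positivity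
  induction X using Finset.strongInduction with
  | H X ih =>
  -- If `X ∈ C`, no induction is needed: the pairs with top `X` cancel all members at least `k`
  -- below it, leaving `X` itself and at most `k - 1` from the levels in between. Otherwise the
  -- bound is averaged over the sets `X.erase x`.
  by_cases hX : X ∈ C
  · have h1 : (C.filter fun B => B ⊆ X) = insert X (C.filter fun B => B ⊂ X) := by
      ext B
      simp only [Finset.mem_filter, Finset.mem_insert, Finset.ssubset_iff_subset_ne]
      constructor
      · rintro ⟨h, h'⟩
        by_cases e : B = X
        · exact Or.inl e
        · exact Or.inr ⟨h, h', e⟩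
      · rintro (rfl | ⟨h, h', -⟩)
        · exact ⟨hX, subset_rfl⟩
        · exact ⟨h, h'⟩
    rw [h1, Finset.sum_insert (by simp)]
    have h2 : ∑ B ∈ C with B ⊂ X, (1 - s B) / X.card.choose B.card ≤
        ∑ B ∈ C with B ⊂ X, (1 : ℝ) / X.card.choose B.card := by
      refine Finset.sum_le_sum fun B _ => ?_
      have := hs0 B
      gcongr
      linarith
    have h3 : ∑ B ∈ C with B ⊂ X, (1 : ℝ) / X.card.choose B.card =
        s X + ∑ B ∈ C with B ⊂ X ∧ X.card < B.card + k, (1 : ℝ) / X.card.choose B.card := by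
      rw [← Finset.sum_filter_add_sum_filter_not _ (fun B => B.card + k ≤ X.card)]
      simp only [Finset.filter_filter, not_le, hs]
    have h4 := sum_high_levels_inv_choose_le X C k
    have h5 : ((k - 1 : ℕ) : ℝ) = k - 1 := by
      rw [Nat.cast_sub hk, Nat.cast_one]
    rw [Nat.choose_self, Nat.cast_one, div_one]
    change 1 - s X + ∑ B ∈ C with B ⊂ X, (1 - s B) / (X.card.choose B.card : ℝ) ≤ k
    linarith
  · have h1 : (C.filter fun B => B ⊆ X) = C.filter fun B => B ⊂ X := by
      refine Finset.filter_congr fun B hB => ?_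
      rw [Finset.ssubset_iff_subset_ne]
      exact ⟨fun h => ⟨h, fun e => hX (e ▸ hB)⟩, fun h => h.1⟩
    rw [h1]
    rcases X.eq_empty_or_nonempty with rfl | hne
    · have : (C.filter fun B => B ⊂ (∅ : Finset ι)) = ∅ := by simp
      rw [this, Finset.sum_empty]
      positivity
    · have hc : (0 : ℝ) < X.card := by exact_mod_cast hne.card_pos
      refine le_of_mul_le_mul_left ?_ hc
      rw [sum_ssubset_inv_choose]
      calc _ ≤ ∑ x ∈ X, (k : ℝ) := by
            refine Finset.sum_le_sum fun x hx => ?_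
            have := ih (X.erase x) (Finset.erase_ssubset hx)
            rwa [Finset.card_erase_of_mem hx] at this
        _ = X.card * k := by simp

/-- The Lubell function of a family of subsets of `[n]`. -/
noncomputable def lubell {n : ℕ} (C : Finset (Finset (Fin n))) : ℝ :=
  ∑ A ∈ C, (1 : ℝ) / n.choose A.card

theorem card_le_lubell_mul {n : ℕ} (C : Finset (Finset (Fin n))) :
    (C.card : ℝ) ≤ lubell C * n.choose (n / 2) := by
  rw [lubell, Finset.sum_mul, Finset.card_eq_sum_ones, Nat.cast_sum]
  refine Finset.sum_le_sum fun A _ => ?_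
  have h1 : (0 : ℝ) < n.choose A.card := by
    exact_mod_cast Nat.choose_pos (by simpa using Finset.card_le_univ A)
  have h2 : (n.choose A.card : ℝ) ≤ n.choose (n / 2) := by exact_mod_cast Nat.choose_le_middle _ _
  rw [one_div, inv_mul_eq_div, le_div_iff₀ h1]
  simpa using h2

/-- The supersaturation inequality for `X = univ`, with the chain probability of each pair `A ⊂ B`
factored through its lower member instead of its upper one. -/
theorem lubell_le_add_sum_upper {n k : ℕ} (hk : 1 ≤ k) (C : Finset (Finset (Fin n))) :
    lubell C ≤ k + ∑ A ∈ C, (1 / n.choose A.card *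
      ∑ B ∈ C with A ⊂ B ∧ A.card + k ≤ B.card,
        (1 : ℝ) / (n - A.card).choose (B.card - A.card)) := by
  have h := sum_one_sub_pairs_le C hk Finset.univ
  simp only [Finset.subset_univ, Finset.filter_true, Finset.card_univ, Fintype.card_fin,
    sub_div, Finset.sum_sub_distrib] at h
  have h2 : ∑ B ∈ C, (∑ A ∈ C with A ⊂ B ∧ A.card + k ≤ B.card,
      (1 : ℝ) / B.card.choose A.card) / n.choose B.card = ∑ A ∈ C, (1 / n.choose A.card *
      ∑ B ∈ C with A ⊂ B ∧ A.card + k ≤ B.card,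
        (1 : ℝ) / (n - A.card).choose (B.card - A.card)) := by
    simp only [Finset.sum_div, Finset.mul_sum, Finset.sum_filter]
    rw [Finset.sum_comm]
    refine Finset.sum_congr rfl fun A _ => Finset.sum_congr rfl fun B _ => ?_
    split_ifs with hAB
    · have hBn : B.card ≤ n := by simpa using Finset.card_le_univ B
      have hA := Finset.card_le_card hAB.1.subset
      have h3 : (n.choose B.card * B.card.choose A.card : ℝ) =
          n.choose A.card * (n - A.card).choose (B.card - A.card) := by
        exact_mod_cast Nat.choose_mul hA
      rw [div_div, mul_comm (B.card.choose A.card : ℝ), h3, div_mul_div_comm, one_mul]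
    · simp
  unfold lubell
  linarith

/-- Levels beyond gap `k` have weight smaller by a factor of order `1 / m`, so that even `n` of them
together are comparable to level `k` when `n` is of order `m`. -/
theorem inv_choose_add_le {m k l N : ℕ} (hl : k < l) (hN : m + l ≤ N) :
    (1 : ℝ) / N.choose l ≤ (k + 1) / ((m + 1) * (m + k).choose k) := by
  have h1 : (m + k + 1).choose (k + 1) ≤ N.choose l := by
    calc (m + k + 1).choose (k + 1) = (m + k + 1).choose m := by
          rw [← Nat.choose_symm_of_eq_add (by ring : m + k + 1 = m + (k + 1))]
      _ ≤ (m + l).choose m := Nat.choose_le_choose _ (by omega)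
      _ = (m + l).choose l := Nat.choose_symm_add
      _ ≤ N.choose l := Nat.choose_le_choose _ hN
  have h2 := Nat.add_one_mul_choose_eq (m + k) k
  have h3 : (0 : ℝ) < (m + k).choose k := by exact_mod_cast Nat.choose_pos (by omega)
  have h4 : ((m + k + 1 : ℕ) : ℝ) * (m + k).choose k = (m + k + 1).choose (k + 1) * (k + 1) := by
    exact_mod_cast h2
  have h5 : ((m + k + 1).choose (k + 1) : ℝ) ≤ N.choose l := by exact_mod_cast h1
  have h6 : (0 : ℝ) < (m + k + 1).choose (k + 1) := by exact_mod_cast Nat.choose_pos (by omega)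
  rw [div_le_div_iff₀ (by linarith) (by positivity), one_mul]
  calc ((m : ℝ) + 1) * (m + k).choose k ≤ ((m + k + 1 : ℕ) : ℝ) * (m + k).choose k := by
        gcongr
        push_cast
        linarith [k.cast_nonneg (α := ℝ)]
    _ = (k + 1) * (m + k + 1).choose (k + 1) := by rw [h4, mul_comm]
    _ ≤ (k + 1) * N.choose l := by gcongr

/-- A family of sets of size at most `n - m` with Lubell function larger than `k` has a member with
many members above it in a single level. -/
theorem exists_large_upper_level {n m k d : ℕ} (hk : 1 ≤ k) (hn : n ≤ 4 * m + 4)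
    (C : Finset (Finset (Fin n))) (hC : ∀ A ∈ C, A.card + m ≤ n) {t : ℝ}
    (hd : d * (4 * k + 5) ≤ t * (m + k).choose k) (hL : k < (1 - t) * lubell C) :
    ∃ A ∈ C, ∃ l, d ≤ (C.filter fun B => A ⊂ B ∧ B.card = A.card + l).card := by
  by_contra! hcon
  have hK : (0 : ℝ) < (m + k).choose k := by exact_mod_cast Nat.choose_pos (by omega)
  -- If every upper level has fewer than `d` members, the pairs above each `A` have total weight at
  -- most `t`. Summing over `A` gives `lubell C ≤ k + t * lubell C`, against `hL`.
  have hinner : ∀ A ∈ C, ∑ B ∈ C with A ⊂ B ∧ A.card + k ≤ B.card,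
      (1 : ℝ) / (n - A.card).choose (B.card - A.card) ≤ t := by
    intro A hA
    have hmap : ∀ B ∈ C.filter fun B => A ⊂ B ∧ A.card + k ≤ B.card,
        B.card - A.card ∈ Finset.Icc k (k + n) := by
      intro B hB
      obtain ⟨h0, h1, h2⟩ := Finset.mem_filter.1 hB
      have := hC B h0
      rw [Finset.mem_Icc]
      omega
    have hfib : ∀ l ∈ Finset.Icc k (k + n), ∀ c : ℝ, 0 ≤ c →
        (m + l ≤ n - A.card → (1 : ℝ) / (n - A.card).choose l ≤ c) →
        ∑ B ∈ (C.filter fun B => A ⊂ B ∧ A.card + k ≤ B.card) with B.card - A.card = l,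
          (1 : ℝ) / (n - A.card).choose (B.card - A.card) ≤ d * c := by
      intro l hl c hc0 hc
      calc _ ≤ ∑ B ∈ (C.filter fun B => A ⊂ B ∧ A.card + k ≤ B.card) with B.card - A.card = l,
            c := by
            refine Finset.sum_le_sum fun B hB => ?_
            simp only [Finset.mem_filter] at hB
            have h1 := hC B hB.1.1
            have h2 := hB.1.2.2
            have h3 := hB.2
            rw [h3]
            exact hc (by omega)
        _ ≤ d * c := by
            rw [Finset.sum_const, nsmul_eq_mul]
            gcongr
            refine le_trans (Finset.card_le_card fun B hB => ?_) (hcon A hA l).le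
            simp only [Finset.mem_filter] at hB ⊢
            exact ⟨hB.1.1, hB.1.2.1, by omega⟩
    rw [← Finset.sum_fiberwise_of_maps_to hmap, ← Finset.add_sum_Ioc_eq_sum_Icc (by omega)]
    have hfirst := hfib k (by simp) (1 / (m + k).choose k) (by positivity) fun h => by
      have : ((m + k).choose k : ℝ) ≤ (n - A.card).choose k := by
        exact_mod_cast Nat.choose_le_choose _ h
      gcongr
    have hrest : ∑ l ∈ Finset.Ioc k (k + n),
        ∑ B ∈ (C.filter fun B => A ⊂ B ∧ A.card + k ≤ B.card) with B.card - A.card = l,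
          (1 : ℝ) / (n - A.card).choose (B.card - A.card)
        ≤ n * (d * ((k + 1) / ((m + 1) * (m + k).choose k))) := by
      calc _ ≤ ∑ l ∈ Finset.Ioc k (k + n), d * ((k + 1 : ℝ) / ((m + 1) * (m + k).choose k)) := by
            refine Finset.sum_le_sum fun l hl => hfib l ?_ _ (by positivity) fun h => ?_
            · exact Finset.Ioc_subset_Icc_self hl
            · exact inv_choose_add_le (Finset.mem_Ioc.1 hl).1 h
        _ = _ := by simp
    have hn' : (n : ℝ) ≤ 4 * (m + 1) := by
      have : (n : ℝ) ≤ 4 * m + 4 := by exact_mod_cast hn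
      linarith
    refine (add_le_add hfirst hrest).trans ?_
    -- The constant is `4 * k + 5 = 1 + 4 * (k + 1)`: gap `k` contributes 1, and the `n ≤ 4 * (m +
    -- 1)` larger gaps contribute `(k + 1) / (m + 1)` each.
    have hm : (0 : ℝ) < m + 1 := by positivity
    calc (d : ℝ) * (1 / (m + k).choose k) + n * (d * ((k + 1) / ((m + 1) * (m + k).choose k)))
        ≤ d * (1 / (m + k).choose k) +
            4 * (m + 1) * (d * ((k + 1) / ((m + 1) * (m + k).choose k))) := by gcongr
      _ = d * (4 * k + 5) / (m + k).choose k := by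
          field_simp
          ring
      _ ≤ t := by rwa [div_le_iff₀ hK]
  have h := lubell_le_add_sum_upper hk C
  have h2 : ∑ A ∈ C, (1 / n.choose A.card * ∑ B ∈ C with A ⊂ B ∧ A.card + k ≤ B.card,
        (1 : ℝ) / (n - A.card).choose (B.card - A.card)) ≤ lubell C * t := by
    rw [lubell, Finset.sum_mul]
    refine Finset.sum_le_sum fun A hA => ?_
    gcongr
    exact hinner A hA
  linarith

end Lubell

/-! ### Vee-free families. -/

/-- Every antichain of `F` that lies strictly above a member of `F` has at most `r` elements. -/
def VeeFree {n : ℕ} (r : ℕ) (F : Finset (Finset (Fin n))) : Prop :=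
  ∀ A ∈ F, ∀ U ⊆ F, IsAntichain (· ⊆ ·) (U : Set (Finset (Fin n))) → (∀ B ∈ U, A ⊂ B) → U.card ≤ r

theorem VeeFree.subset {n r : ℕ} (I J : Finset (Finset (Fin n))) (h : J ⊆ I) (hI : VeeFree r I) :
    VeeFree r J :=
  fun A hA U hU => hI A (h hA) U (hU.trans h)

theorem VeeFree.card_inter_level_le {n r : ℕ} {I C : Finset (Finset (Fin n))} (hI : VeeFree r I)
    {A : Finset (Fin n)} (hA : A ∈ I) (l : ℕ) :
    (I ∩ C.filter fun B => A ⊂ B ∧ B.card = A.card + l).card ≤ r := by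
  refine hI A hA _ Finset.inter_subset_left ?_ ?_
  · intro B hB D hD hne hsub
    simp only [Finset.coe_inter, Finset.coe_filter, Set.mem_inter_iff, Set.mem_ofPred_eq] at hB hD
    exact hne (Finset.eq_of_subset_of_card_le hsub (by omega))
  · intro B hB
    simp only [Finset.mem_inter, Finset.mem_filter] at hB
    exact hB.2.2.1

/-- The exponential moment of the largest `VeeFree r` subfamily grows slowly on families which are
large in the sense of the Lubell function. -/
theorem expMaxCard_veeFree_le {n m k d r : ℕ} (hk : 1 ≤ k) (hn : n ≤ 4 * m + 4)
    {M : Finset (Finset (Fin n))} (hM : ∀ A ∈ M, A.card + m ≤ n) {t L : ℝ}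
    (hd : d * (4 * k + 5) ≤ t * (m + k).choose k) (ht : t < 1) (hL : k ≤ (1 - t) * L)
    {p l x B : ℝ} (hp0 : 0 ≤ p) (hp1 : p ≤ 1) (hl : 0 ≤ l) (hx1 : 1 ≤ x) (hB : 0 ≤ B)
    (hx : 1 + p * Real.exp (l * (r + 1)) / x ^ d ≤ x)
    (hsmall : ∀ C ⊆ M, lubell C ≤ L → expMaxCard (VeeFree r) p l C ≤ B) :
    expMaxCard (VeeFree r) p l M ≤ B * x ^ M.card := by
  refine expMaxCard_le_mul_pow VeeFree.subset hp0 hp1 hl (r := r) hx1 hB hx (fun C => lubell C ≤ L)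
    hsmall (fun C hC hs => ?_) M subset_rfl
  have hs' : L < lubell C := not_le.1 hs
  obtain ⟨A, hA, j, hj⟩ := exists_large_upper_level hk hn C (fun A hA => hM A (hC hA)) hd
    (hL.trans_lt (mul_lt_mul_of_pos_left hs' (by linarith)))
  exact ⟨A, hA, _, Finset.filter_subset _ _, by simp, hj,
    fun I hI hAI => hI.card_inter_level_le hAI j⟩

/-! ### Induced copies and the reduction to vee-free families. -/

theorem isInducedCopy_range {n l : ℕ} {r : Fin l → ℕ}
    (f : CompleteMultipartite r → Finset (Fin n)) (hlt : ∀ x y, x.1 < y.1 → f x ⊂ f y)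
    (hanti : ∀ x y, x.1 = y.1 → f x ⊆ f y → x = y) :
    IsInducedCopy (CompleteMultipartite r) (Set.range f) := by
  have key : ∀ x y, x ≤ y ↔ f x ⊆ f y := by
    intro x y
    constructor
    · rintro (rfl | h)
      · exact subset_rfl
      · exact (hlt _ _ h).subset
    · intro h
      rcases lt_trichotomy x.1 y.1 with h' | h' | h'
      · exact Or.inr h'
      · exact Or.inl (hanti x y h' h)
      · exact absurd h (hlt _ _ h').not_subset
  have hinj : Function.Injective f := fun x y h =>
    le_antisymm ((key x y).2 h.subset) ((key y x).2 h.symm.subset)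
  exact ⟨Equiv.ofInjective f hinj, fun x y => key x y⟩

theorem exists_antichain_enumeration {n k : ℕ} {F U : Finset (Finset (Fin n))} (hU : U ⊆ F)
    (hanti : IsAntichain (· ⊆ ·) (U : Set (Finset (Fin n)))) (hk : k ≤ U.card) :
    ∃ g : Fin k → Finset (Fin n), (∀ i, g i ∈ U ∧ g i ∈ F) ∧ ∀ i j, g i ⊆ g j → i = j := by
  let e := (Fin.castLEEmb hk).trans U.equivFin.symm.toEmbedding
  refine ⟨fun i => e i, fun i => ⟨(e i).2, hU (e i).2⟩, fun i j h => ?_⟩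
  by_contra hne
  exact hanti (e i).2 (e j).2 (fun h' => hne (e.injective (Subtype.ext h'))) h

theorem IsInducedFree.veeFree {n r : ℕ} {F : Finset (Finset (Fin n))}
    (hF : IsInducedFree (VeePoset (r + 1)) (F : Set (Finset (Fin n)))) : VeeFree r F := by
  intro A hA U hU hanti hAU
  by_contra! hcard
  obtain ⟨g, hg, hg'⟩ := exists_antichain_enumeration hU hanti (Nat.succ_le_of_lt hcard)
  let f : VeePoset (r + 1) → Finset (Fin n) := fun x =>
    match x with
    | ⟨0, _⟩ => A
    | ⟨1, j⟩ => g j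
  refine hF (Set.range f) ?_ (isInducedCopy_range f ?_ ?_)
  · rintro _ ⟨⟨i, j⟩, rfl⟩
    fin_cases i
    · exact hA
    · exact (hg j).2
  · rintro ⟨i, j⟩ ⟨i', j'⟩ h
    replace h : i < i' := h
    fin_cases i <;> fin_cases i' <;> try exact absurd h (by decide)
    exact hAU _ (hg j').1
  · rintro ⟨i, j⟩ ⟨i', j'⟩ rfl h
    fin_cases i
    · exact congrArg _ (Subsingleton.elim (α := Fin 1) j j')
    · exact congrArg _ (hg' j j' h)

theorem IsInducedFree.card_below_lt {n s t : ℕ} {F : Finset (Finset (Fin n))}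
    (hF : IsInducedFree (KPoset s t) (F : Set (Finset (Fin n)))) {B : Finset (Fin n)} (hB : B ∈ F)
    {U D : Finset (Finset (Fin n))} (hU : U ⊆ F)
    (hUanti : IsAntichain (· ⊆ ·) (U : Set (Finset (Fin n)))) (hBU : ∀ A ∈ U, B ⊂ A)
    (ht : t ≤ U.card) (hD : D ⊆ F) (hDanti : IsAntichain (· ⊆ ·) (D : Set (Finset (Fin n))))
    (hBD : ∀ A ∈ D, A ⊂ B) : D.card < s := by
  by_contra! hs
  obtain ⟨g, hg, hg'⟩ := exists_antichain_enumeration hU hUanti ht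
  obtain ⟨k, hk, hk'⟩ := exists_antichain_enumeration hD hDanti hs
  let f : KPoset s t → Finset (Fin n) := fun x =>
    match x with
    | ⟨0, j⟩ => k j
    | ⟨1, _⟩ => B
    | ⟨2, j⟩ => g j
  refine hF (Set.range f) ?_ (isInducedCopy_range f ?_ ?_)
  · rintro _ ⟨⟨i, j⟩, rfl⟩
    fin_cases i
    · exact (hk j).2
    · exact hB
    · exact (hg j).2
  · rintro ⟨i, j⟩ ⟨i', j'⟩ h
    replace h : i < i' := h
    fin_cases i <;> fin_cases i' <;> try exact absurd h (by decide)
    · exact hBD _ (hk j).1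
    · exact (hBD _ (hk j).1).trans (hBU _ (hg j').1)
    · exact hBU _ (hg j').1
  · rintro ⟨i, j⟩ ⟨i', j'⟩ rfl h
    fin_cases i
    · exact congrArg _ (hk' j j' h)
    · exact congrArg _ (Subsingleton.elim (α := Fin 1) j j')
    · exact congrArg _ (hg' j j' h)

/-- Complementation of subsets of `[n]`. -/
def complEquiv (n : ℕ) : Finset (Fin n) ≃ Finset (Fin n) := compl_involutive.toPerm

/-- Split by `R`, which says that no antichain of size `t` lies above the given set. Members failing
`R` have no `s`-antichain below them by `IsInducedFree.card_below_lt`; complementation turns below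
into above. -/
theorem IsInducedFree.card_le_add {n s t : ℕ} {F : Finset (Finset (Fin n))} (hs : 1 ≤ s)
    (hF : IsInducedFree (KPoset s t) (F : Set (Finset (Fin n)))) :
    F.card ≤ maxCard (VeeFree (t - 1)) F +
      maxCard (VeeFree (s - 1)) (F.map (complEquiv n).toEmbedding) := by
  classical
  let R : Finset (Fin n) → Prop := fun B => ∀ U ⊆ F,
    IsAntichain (· ⊆ ·) (U : Set (Finset (Fin n))) → (∀ A ∈ U, B ⊂ A) → U.card ≤ t - 1
  have h1 : (F.filter R).card ≤ maxCard (VeeFree (t - 1)) F := by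
    refine card_le_maxCard (fun A hA U hU => ?_) (Finset.filter_subset _ _)
    exact (Finset.mem_filter.1 hA).2 U (hU.trans (Finset.filter_subset _ _))
  have h2 : ((F.filter fun B => ¬ R B).map (complEquiv n).toEmbedding).card ≤
      maxCard (VeeFree (s - 1)) (F.map (complEquiv n).toEmbedding) := by
    refine card_le_maxCard (fun A hA V hV hanti hAV => ?_)
      (Finset.map_subset_map.2 (Finset.filter_subset _ _))
    obtain ⟨B, hB, rfl⟩ := Finset.mem_map.1 hA
    obtain ⟨hBF, hBR⟩ := Finset.mem_filter.1 hB
    simp only [R, not_forall, not_le] at hBR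
    obtain ⟨U, hU, hUanti, hBU, hUc⟩ := hBR
    have hmem : ∀ D ∈ V.map (complEquiv n).toEmbedding, Dᶜ ∈ V := by
      intro D hD
      obtain ⟨E, hE, rfl⟩ := Finset.mem_map.1 hD
      change Eᶜᶜ ∈ V
      rwa [compl_compl]
    have h3 := hF.card_below_lt hBF hU hUanti hBU (by omega)
      (D := V.map (complEquiv n).toEmbedding) ?_ ?_ ?_
    · rw [Finset.card_map] at h3
      omega
    · intro D hD
      obtain ⟨E, hE, hED⟩ := Finset.mem_map.1 (hV (hmem D hD))
      have : E = D := compl_injective hED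
      exact this ▸ (Finset.mem_filter.1 hE).1
    · intro D hD E hE hne hDE
      exact hanti (hmem E hE) (hmem D hD) (fun h => hne (compl_injective h).symm)
        (Finset.compl_subset_compl.2 hDE)
    · intro D hD
      have : Bᶜ ⊂ Dᶜ := hAV _ (hmem D hD)
      exact compl_lt_compl_iff_lt.1 this
  rw [Finset.card_map] at h2
  have := Finset.card_filter_add_card_filter_not (s := F) R
  omega

theorem le_largestInducedFree {n : ℕ} {P : Type} [PartialOrder P] [Nonempty P]
    {S F : Finset (Finset (Fin n))} (hFS : F ⊆ S)
    (hF : IsInducedFree P (F : Set (Finset (Fin n)))) :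
    F.card ≤ largestInducedFree P (S : Set (Finset (Fin n))) :=
  (largestInducedFree_isGreatest P _).2
    ⟨F, Finset.coe_subset.2 hFS, hF, Set.ncard_coe_finset F⟩

theorem exists_card_eq_largestInducedFree {n : ℕ} (P : Type) [PartialOrder P] [Nonempty P]
    (S : Finset (Finset (Fin n))) : ∃ F ⊆ S, IsInducedFree P (F : Set (Finset (Fin n))) ∧
      F.card = largestInducedFree P (S : Set (Finset (Fin n))) := by
  obtain ⟨F, hFS, hF, hc⟩ := (largestInducedFree_isGreatest P (S : Set (Finset (Fin n)))).1
  have hcoe : ((F.toFinite.toFinset : Finset (Finset (Fin n))) : Set (Finset (Fin n))) = F := by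
    simp
  refine ⟨F.toFinite.toFinset, ?_, by rwa [hcoe], ?_⟩
  · rw [← Finset.coe_subset, hcoe]
    exact hFS
  · rw [← hc, ← Set.ncard_coe_finset, hcoe]

instance VeePoset.nonempty (r : ℕ) : Nonempty (VeePoset r) := ⟨⟨0, ⟨0, Nat.one_pos⟩⟩⟩

instance KPoset.nonempty (s t : ℕ) : Nonempty (KPoset s t) := ⟨⟨1, ⟨0, Nat.one_pos⟩⟩⟩

theorem maxCard_mono {α : Type*} {Q : Finset α → Prop} {S T : Finset α} (h : S ⊆ T) :
    maxCard Q S ≤ maxCard Q T :=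
  maxCard_le fun _ hI hQI => card_le_maxCard hQI (hI.trans h)

theorem largestInducedFree_veePoset_le {n : ℕ} (r : ℕ) (S : Finset (Finset (Fin n))) :
    largestInducedFree (VeePoset (r + 1)) (S : Set (Finset (Fin n))) ≤ maxCard (VeeFree r) S := by
  obtain ⟨F, hFS, hF, hc⟩ := exists_card_eq_largestInducedFree (VeePoset (r + 1)) S
  exact hc ▸ card_le_maxCard hF.veeFree hFS

theorem largestInducedFree_kPoset_le {n s : ℕ} (hs : 1 ≤ s) (t : ℕ)
    (S : Finset (Finset (Fin n))) :
    largestInducedFree (KPoset s t) (S : Set (Finset (Fin n))) ≤ maxCard (VeeFree (t - 1)) S +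
      maxCard (VeeFree (s - 1)) (S.map (complEquiv n).toEmbedding) := by
  obtain ⟨F, hFS, hF, hc⟩ := exists_card_eq_largestInducedFree (KPoset s t) S
  rw [← hc]
  exact (hF.card_le_add hs).trans
    (add_le_add (maxCard_mono hFS) (maxCard_mono (Finset.map_subset_map.2 hFS)))

theorem IsInducedCopy.exists_strictMono {n : ℕ} {P : Type} [PartialOrder P]
    {G : Set (Finset (Fin n))} (h : IsInducedCopy P G) :
    ∃ f : P → Finset (Fin n), StrictMono f ∧ ∀ x, f x ∈ G := by
  obtain ⟨i, hi⟩ := h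
  refine ⟨fun x => i x, fun x y hxy => ?_, fun x => (i x).2⟩
  rw [lt_iff_le_not_ge] at hxy ⊢
  exact ⟨(hi x y).1 hxy.1, fun h => hxy.2 ((hi y x).2 h)⟩

theorem isInducedFree_veePoset_of_level {n r j : ℕ} {F : Finset (Finset (Fin n))}
    (hF : ∀ A ∈ F, A.card = j) :
    IsInducedFree (VeePoset (r + 1)) (F : Set (Finset (Fin n))) := by
  intro G hG hcopy
  obtain ⟨f, hf, hfG⟩ := hcopy.exists_strictMono
  let x : VeePoset (r + 1) := ⟨0, ⟨0, Nat.one_pos⟩⟩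
  let y : VeePoset (r + 1) := ⟨1, ⟨0, Nat.succ_pos r⟩⟩
  have hxy : x < y := show (0 : Fin 2) < 1 by decide
  have h1 := Finset.card_lt_card (hf hxy)
  rw [hF _ (hG (hfG x)), hF _ (hG (hfG y))] at h1
  exact lt_irrefl _ h1

theorem isInducedFree_kPoset_of_levels {n s t j : ℕ} (hs : 1 ≤ s) (ht : 1 ≤ t)
    {F : Finset (Finset (Fin n))} (hF : ∀ A ∈ F, A.card = j ∨ A.card = j + 1) :
    IsInducedFree (KPoset s t) (F : Set (Finset (Fin n))) := by
  intro G hG hcopy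
  obtain ⟨f, hf, hfG⟩ := hcopy.exists_strictMono
  let x : KPoset s t := ⟨0, ⟨0, hs⟩⟩
  let y : KPoset s t := ⟨1, ⟨0, Nat.one_pos⟩⟩
  let z : KPoset s t := ⟨2, ⟨0, ht⟩⟩
  have hxy : x < y := show (0 : Fin 3) < 1 by decide
  have hyz : y < z := show (1 : Fin 3) < 2 by decide
  have h1 := Finset.card_lt_card (hf hxy)
  have h2 := Finset.card_lt_card (hf hyz)
  have h3 := hF _ (hG (hfG x))
  have h4 := hF _ (hG (hfG z))
  omega

/-! ### Asymptotic estimates and choice of degrees. -/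

/-- The size of the middle level of the power set of `[n]`, as a real number. -/
noncomputable def middle (n : ℕ) : ℝ := n.choose (n / 2)

theorem middle_pos (n : ℕ) : 0 < middle n := by
  unfold middle
  exact_mod_cast Nat.choose_pos (Nat.div_le_self n 2)

theorem two_pow_le_mul_middle (n : ℕ) : (2 : ℝ) ^ n ≤ (n + 1) * middle n := by
  have h : 2 ^ n ≤ (n + 1) * n.choose (n / 2) := by
    rw [← Nat.sum_range_choose]
    refine (Finset.sum_le_card_nsmul _ _ _ fun k _ => Nat.choose_le_middle k n).trans ?_
    simp
  unfold middle
  exact_mod_cast h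

theorem tendsto_mul_natCast_atTop {p : ℕ → ℝ} (hp0 : ∀ n, 0 ≤ p n)
    (hp : (fun n : ℕ => 1 / (n : ℝ)) =o[atTop] p) :
    Tendsto (fun n : ℕ => p n * n) atTop atTop := by
  refine tendsto_atTop.2 fun K => ?_
  have hK : 0 < |K| + 1 := by positivity
  filter_upwards [hp.def (inv_pos.2 hK), eventually_gt_atTop 0] with n hn hn0
  have hn0' : (0 : ℝ) < n := by exact_mod_cast hn0
  rw [Real.norm_of_nonneg (by positivity), Real.norm_of_nonneg (hp0 n), inv_mul_eq_div,
    div_le_div_iff₀ hn0' hK] at hn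
  linarith [le_abs_self K]

theorem tendsto_mul_middle_atTop {p : ℕ → ℝ} (hp0 : ∀ n, 0 ≤ p n)
    (hp : Tendsto (fun n : ℕ => p n * n) atTop atTop) :
    Tendsto (fun n : ℕ => p n * middle n) atTop atTop := by
  refine tendsto_atTop_mono (fun n => mul_le_mul_of_nonneg_left ?_ (hp0 n)) hp
  unfold middle
  have := Nat.choose_le_middle 1 n
  rw [Nat.choose_one_right] at this
  exact_mod_cast this

theorem tendsto_exp_neg_mul_middle {p : ℕ → ℝ} (hp0 : ∀ n, 0 ≤ p n)
    (hp : Tendsto (fun n : ℕ => p n * n) atTop atTop) {δ : ℝ} (hδ : 0 < δ) :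
    Tendsto (fun n : ℕ => Real.exp (-(δ * (p n * middle n)))) atTop (nhds 0) :=
  Real.tendsto_exp_neg_atTop_nhds_zero.comp
    ((tendsto_mul_middle_atTop hp0 hp).const_mul_atTop hδ)

/-- Weighting `A` by `(1 / 2) ^ (n - A.card)` gives total weight `(3 / 2) ^ n`, and `2 ≤ (6 / 5) ^
4` bounds the loss `2 ^ m` by `(6 / 5) ^ n`. -/
theorem card_filter_large_le (n m : ℕ) (hm : 4 * m ≤ n) :
    (((Finset.univ : Finset (Finset (Fin n))).filter fun A => ¬ A.card + m ≤ n).card : ℝ) ≤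
      (9 / 10) ^ n * 2 ^ n := by
  have h1 := Fintype.sum_pow_mul_eq_add_pow (Fin n) (1 : ℝ) (1 / 2)
  simp only [one_pow, one_mul, Fintype.card_fin] at h1
  have h2 : (((Finset.univ : Finset (Finset (Fin n))).filter
      fun A => ¬ A.card + m ≤ n).card : ℝ) * (1 / 2) ^ m ≤ (1 + 1 / 2) ^ n := by
    rw [← h1, ← nsmul_eq_mul]
    refine (Finset.card_nsmul_le_sum _ (fun A : Finset (Fin n) => (1 / 2 : ℝ) ^ (n - A.card)) _
      fun A hA => ?_).trans
      (Finset.sum_le_sum_of_subset_of_nonneg (Finset.subset_univ _) fun _ _ _ => by positivity)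
    have hA' := (Finset.mem_filter.1 hA).2
    exact pow_le_pow_of_le_one (by norm_num) (by norm_num) (by omega)
  have h3 : (2 : ℝ) ^ m ≤ (6 / 5) ^ n := by
    calc (2 : ℝ) ^ m ≤ ((6 / 5) ^ 4) ^ m := by gcongr; norm_num
      _ = (6 / 5) ^ (4 * m) := by rw [pow_mul]
      _ ≤ (6 / 5) ^ n := pow_le_pow_right₀ (by norm_num) hm
  have h4 : (1 / 2 : ℝ) ^ m * 2 ^ m = 1 := by rw [← mul_pow]; norm_num
  set c : ℝ := (((Finset.univ : Finset (Finset (Fin n))).filter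
      fun A => ¬ A.card + m ≤ n).card : ℝ)
  calc c = c * (1 / 2) ^ m * 2 ^ m := by rw [mul_assoc, h4, mul_one]
    _ ≤ (1 + 1 / 2) ^ n * (6 / 5) ^ n := by gcongr
    _ = (9 / 10) ^ n * 2 ^ n := by
      rw [← mul_pow, ← mul_pow]
      norm_num

theorem eventually_card_filter_large_le {η : ℝ} (hη : 0 < η) :
    ∀ᶠ n : ℕ in atTop, (((Finset.univ : Finset (Finset (Fin n))).filter
      fun A => ¬ A.card + n / 4 ≤ n).card : ℝ) ≤ η * middle n := by
  have h : Tendsto (fun n : ℕ => (n : ℝ) * (9 / 10) ^ n + (9 / 10) ^ n) atTop (nhds (0 + 0)) :=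
    (tendsto_self_mul_const_pow_of_lt_one (by norm_num) (by norm_num)).add
      (tendsto_pow_atTop_nhds_zero_of_lt_one (by norm_num) (by norm_num))
  rw [add_zero] at h
  filter_upwards [h.eventually_le_const hη] with n hn
  calc _ ≤ (9 / 10 : ℝ) ^ n * 2 ^ n := card_filter_large_le n (n / 4) (by omega)
    _ ≤ (9 / 10) ^ n * ((n + 1) * middle n) := by
      gcongr
      exact two_pow_le_mul_middle n
    _ = (n * (9 / 10) ^ n + (9 / 10) ^ n) * middle n := by ring
    _ ≤ η * middle n := by
      gcongr
      exact (middle_pos n).le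

/-- With `x = exp (p * θ)`, the inequality `x ≥ 1 + p * θ` reduces the growth condition to a
comparison free of the factor `p`. -/
theorem one_add_mul_exp_div_le {p c θ : ℝ} {d : ℕ} (hp : 0 ≤ p)
    (h : Real.exp (c - p * θ * d) ≤ θ) :
    1 + p * Real.exp c / Real.exp (p * θ) ^ d ≤ Real.exp (p * θ) := by
  have h1 : p * Real.exp c / Real.exp (p * θ) ^ d = p * Real.exp (c - p * θ * d) := by
    rw [← Real.exp_nat_mul, mul_div_assoc, ← Real.exp_sub]
    ring_nf
  rw [h1]
  have := Real.add_one_le_exp (p * θ)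
  nlinarith

/-- Degrees of order `n` suffice for the growth condition with a constant rate. -/
theorem eventually_growth_linear {p : ℕ → ℝ} (hp0 : ∀ n, 0 ≤ p n) (hp1 : ∀ n, p n ≤ 1)
    (hp : Tendsto (fun n : ℕ => p n * n) atTop atTop) (c : ℝ) {η t : ℝ} (hη : 0 < η)
    (ht : 0 < t) :
    ∀ᶠ n : ℕ in atTop, ∃ d : ℕ, d * (4 * (1 : ℕ) + 5) ≤ t * (n / 4 + 1).choose 1 ∧
      1 + p n * Real.exp c / Real.exp (p n * η) ^ d ≤ Real.exp (p n * η) := by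
  have h1 : Tendsto (fun n : ℕ => η * (t / 36) * (p n * n) + (- η - c)) atTop atTop :=
    tendsto_atTop_add_const_right _ _ (hp.const_mul_atTop (by positivity))
  have h2 := Real.tendsto_exp_neg_atTop_nhds_zero.comp h1
  filter_upwards [h2.eventually_le_const hη] with n hn
  -- The 9 is `4 * 1 + 5`; this `d` is at least `t * n / 36 - 1`, so `p n * d → ∞`.
  refine ⟨⌊t * (n / 4 + 1 : ℕ) / 9⌋₊, ?_, one_add_mul_exp_div_le (hp0 n) (le_trans ?_ hn)⟩
  · have := Nat.floor_le (a := t * (n / 4 + 1 : ℕ) / 9) (by positivity)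
    rw [Nat.choose_one_right]
    push_cast at this ⊢
    linarith
  · have h3 := (Nat.sub_one_lt_floor (t * (n / 4 + 1 : ℕ) / 9)).le
    have h4 : (n : ℝ) ≤ 4 * (n / 4 + 1 : ℕ) := by exact_mod_cast (by omega : n ≤ 4 * (n / 4 + 1))
    have h5 : t / 36 * n - 1 ≤ (⌊t * (n / 4 + 1 : ℕ) / 9⌋₊ : ℝ) := by
      refine le_trans ?_ h3
      have := mul_le_mul_of_nonneg_left h4 ht.le
      linarith
    have h6 : p n * η * (t / 36 * n - 1) ≤ p n * η * (⌊t * (n / 4 + 1 : ℕ) / 9⌋₊ : ℝ) := by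
      have := hp0 n
      gcongr
    have h7 : p n * η ≤ η := mul_le_of_le_one_left hη.le (hp1 n)
    rw [Function.comp, Real.exp_le_exp]
    linarith

/-- Degrees of order `n ^ 3` suffice for the growth condition with rate of order `1 / n`. -/
theorem eventually_growth_cubic {p : ℕ → ℝ} (hp0 : ∀ n, 0 ≤ p n) (hp1 : ∀ n, p n ≤ 1)
    (hp : Tendsto (fun n : ℕ => p n * n) atTop atTop) (c : ℝ) {η : ℝ} (hη : 0 < η) :
    ∀ᶠ n : ℕ in atTop, ∃ d : ℕ, d * (4 * (3 : ℕ) + 5) ≤ (1 / 4 : ℝ) * (n / 4 + 3).choose 3 ∧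
      1 + p n * Real.exp c / Real.exp (p n * (η / (n + 1))) ^ d ≤
        Real.exp (p n * (η / (n + 1))) := by
  have h1 : Tendsto (fun n : ℕ => ((n : ℝ) + 1) * Real.exp (-(η / 52224 * n)))
      atTop (nhds 0) := by
    have hη' : Real.exp (-(η / 52224)) < 1 := Real.exp_lt_one_iff.2 (by
      linarith [div_pos hη (by norm_num : (0 : ℝ) < 52224)])
    have h := (tendsto_self_mul_const_pow_of_lt_one (Real.exp_pos _).le hη').add
      (tendsto_pow_atTop_nhds_zero_of_lt_one (Real.exp_pos _).le hη')
    rw [add_zero] at h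
    refine h.congr fun n => ?_
    rw [← Real.exp_nat_mul]
    ring_nf
  filter_upwards [h1.eventually_le_const (show 0 < η * Real.exp (-(c + η)) by positivity),
    hp.eventually_ge_atTop 1, eventually_ge_atTop 1] with n hn hpn hn1
  have hn1' : (1 : ℝ) ≤ n := by exact_mod_cast hn1
  have hchoose : (((n / 4 + 1 : ℕ) : ℝ)) ^ 3 ≤ 6 * (n / 4 + 3).choose 3 := by
    have := Nat.pow_le_choose (α := ℝ) 3 (n / 4 + 3)
    rw [show n / 4 + 3 + 1 - 3 = n / 4 + 1 by omega, div_le_iff₀ (by positivity)] at this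
    norm_num [Nat.factorial] at this ⊢
    linarith
  have h4 : (n : ℝ) / 4 ≤ (n / 4 + 1 : ℕ) := by
    have : (n : ℝ) ≤ 4 * (n / 4 + 1 : ℕ) := by exact_mod_cast (by omega : n ≤ 4 * (n / 4 + 1))
    linarith
  have h5 : (n : ℝ) ^ 3 / 26112 ≤ (n / 4 + 3).choose 3 / 68 := by
    have : ((n : ℝ) / 4) ^ 3 ≤ (n / 4 + 1 : ℕ) ^ 3 := by gcongr
    have h6 : ((n : ℝ) / 4) ^ 3 = n ^ 3 / 64 := by ring
    linarith
  -- Here `68 = 4 * (4 * 3 + 5)` and `26112 = 6 * 64 * 68`. Since `p n * n ≥ 1`, the exponent `p n *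
  -- (η / (n + 1)) * d` grows linearly in `n`, and its exponential beats `n + 1`.
  refine ⟨⌊((n / 4 + 3).choose 3 : ℝ) / 68⌋₊, ?_, one_add_mul_exp_div_le (hp0 n) ?_⟩
  · have := Nat.floor_le (a := ((n / 4 + 3).choose 3 : ℝ) / 68) (by positivity)
    push_cast
    linarith
  · set d : ℕ := ⌊((n / 4 + 3).choose 3 : ℝ) / 68⌋₊
    have h6 : (n : ℝ) ^ 3 / 26112 - 1 ≤ d :=
      (by linarith [Nat.sub_one_lt_floor (((n / 4 + 3).choose 3 : ℝ) / 68)])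
    have hp0n := hp0 n
    have h7 : η / 52224 * n - η ≤ p n * (η / (n + 1)) * d := by
      have h8 : p n * (η / (n + 1)) * ((n : ℝ) ^ 3 / 26112 - 1) ≤ p n * (η / (n + 1)) * d := by
        gcongr
      refine le_trans ?_ h8
      have h9 : (n : ℝ) ^ 2 ≤ p n * n ^ 3 := by
        have : (n : ℝ) ^ 2 * 1 ≤ n ^ 2 * (p n * n) := by gcongr
        linarith
      have h10 : n ^ 2 / 26112 - (1 : ℝ) ≤ p n * ((n : ℝ) ^ 3 / 26112 - 1) := by
        linarith [hp1 n]
      have h11 : η / (n + 1) * (n ^ 2 / 26112 - (1 : ℝ)) ≤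
          η / (n + 1) * (p n * ((n : ℝ) ^ 3 / 26112 - 1)) := by gcongr
      refine le_trans ?_ (h11.trans_eq (by ring))
      rw [div_mul_eq_mul_div η ((n : ℝ) + 1), le_div_iff₀ (by positivity)]
      have : ((n : ℝ) / 52224 - 1) * (n + 1) ≤ n ^ 2 / 26112 - 1 := by nlinarith
      calc (η / 52224 * n - η) * (n + 1) = η * (((n : ℝ) / 52224 - 1) * (n + 1)) := by ring
        _ ≤ η * (n ^ 2 / 26112 - 1) := by gcongr
    calc Real.exp (c - p n * (η / (n + 1)) * d) ≤ Real.exp (c + η + -(η / 52224 * n)) := by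
          rw [Real.exp_le_exp]
          linarith
      _ = Real.exp (c + η) * Real.exp (-(η / 52224 * n)) := Real.exp_add _ _
      _ ≤ η / (n + 1) := by
          rw [le_div_iff₀ (by positivity)]
          calc Real.exp (c + η) * Real.exp (-(η / 52224 * n)) * (n + 1)
              = Real.exp (c + η) * ((n + 1) * Real.exp (-(η / 52224 * n))) := by ring
            _ ≤ Real.exp (c + η) * (η * Real.exp (-(c + η))) := by gcongr
            _ = η := by
              rw [mul_left_comm, ← Real.exp_add]
              simp

/-! ### Upper tail for vee-free subfamilies. -/

/-- The exponential moment of the largest `VeeFree r` subfamily of the random family. -/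
theorem eventually_expMaxCard_univ_le {p : ℕ → ℝ} (hp0 : ∀ n, 0 ≤ p n) (hp1 : ∀ n, p n ≤ 1)
    (hp : Tendsto (fun n : ℕ => p n * n) atTop atTop) (r : ℕ) {l ε η : ℝ} (hl : 0 < l)
    (hε : 0 < ε) (hη : 0 < η) :
    ∀ᶠ n : ℕ in atTop, expMaxCard (VeeFree r) (p n) l (Finset.univ : Finset (Finset (Fin n))) ≤
      Real.exp (((Real.exp l - 1) * (1 + ε + η) + 5 * η) * (p n * middle n)) := by
  -- With `t = ε / (1 + ε)`, one has `(1 - t) * (1 + ε) = 1`, the value of `k` in the stage ending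
  -- at Lubell value `1 + ε`.
  have ht : 0 < ε / (1 + ε) := by positivity
  filter_upwards [eventually_card_filter_large_le hη,
    eventually_growth_linear hp0 hp1 hp (l * (r + 1)) hη ht,
    eventually_growth_cubic hp0 hp1 hp (l * (r + 1)) hη] with n hlarge ⟨d, hd, hx⟩ ⟨d', hd', hx'⟩
  have hpn := hp0 n
  have hN := middle_pos n
  have ha : 0 ≤ Real.exp l - 1 := by linarith [Real.add_one_le_exp l]
  set M := (Finset.univ : Finset (Finset (Fin n))).filter fun A => A.card + n / 4 ≤ n with hMdef
  have hM : ∀ A ∈ M, A.card + n / 4 ≤ n := fun A hA => (Finset.mem_filter.1 hA).2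
  have hsmall : ∀ C ⊆ M, lubell C ≤ 1 + ε → expMaxCard (VeeFree r) (p n) l C ≤
      Real.exp ((Real.exp l - 1) * (1 + ε) * (p n * middle n)) := by
    intro C _ hC
    refine (expMaxCard_le_exp_card VeeFree.subset hpn (hp1 n) hl.le C).trans ?_
    rw [Real.exp_le_exp]
    calc p n * (Real.exp l - 1) * C.card
        ≤ p n * (Real.exp l - 1) * ((1 + ε) * middle n) := by
          gcongr
          exact (card_le_lubell_mul C).trans (mul_le_mul_of_nonneg_right hC hN.le)
      _ = _ := by ring
  have hmedium : ∀ C ⊆ M, lubell C ≤ 4 → expMaxCard (VeeFree r) (p n) l C ≤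
      Real.exp (((Real.exp l - 1) * (1 + ε) + 4 * η) * (p n * middle n)) := by
    intro C hCM hC
    refine (expMaxCard_veeFree_le (k := 1) le_rfl (by omega) (fun A hA => hM A (hCM hA)) hd
      (by rw [div_lt_one (by positivity)]; linarith) (L := 1 + ε) ?_ hpn (hp1 n) hl.le
      (Real.one_le_exp (by positivity)) (Real.exp_pos _).le hx
      fun C' hC' => hsmall C' (hC'.trans hCM)).trans ?_
    · push_cast
      field_simp
      linarith
    · rw [← Real.exp_nat_mul, ← Real.exp_add, Real.exp_le_exp]
      have : (C.card : ℝ) ≤ 4 * middle n :=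
        (card_le_lubell_mul C).trans (mul_le_mul_of_nonneg_right hC hN.le)
      have : (C.card : ℝ) * (p n * η) ≤ 4 * middle n * (p n * η) := by gcongr
      linarith
  -- Gap `k = 3` with `t = 1 / 4` stops at Lubell value 4, as `3 = (1 - 1 / 4) * 4`. The rate `η /
  -- (n + 1)` makes the cost over all of `M` at most `η * (p n * middle n)`.
  have hall : expMaxCard (VeeFree r) (p n) l M ≤
      Real.exp (((Real.exp l - 1) * (1 + ε) + 5 * η) * (p n * middle n)) := by
    refine (expMaxCard_veeFree_le (k := 3) (by norm_num) (by omega) hM hd' (by norm_num) (L := 4)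
      (by norm_num) hpn (hp1 n) hl.le (Real.one_le_exp (by positivity)) (Real.exp_pos _).le hx'
      hmedium).trans ?_
    rw [← Real.exp_nat_mul, ← Real.exp_add, Real.exp_le_exp]
    have h1 : (M.card : ℝ) ≤ 2 ^ n := by
      have := Finset.card_le_univ M
      rw [Fintype.card_finset, Fintype.card_fin] at this
      exact_mod_cast this
    have h2 : (M.card : ℝ) ≤ (n + 1) * middle n := h1.trans (two_pow_le_mul_middle n)
    have h3 : (M.card : ℝ) * (p n * (η / (n + 1))) ≤ (n + 1) * middle n * (p n * (η / (n + 1))) := by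
      gcongr
    have h4 : (n + 1) * middle n * (p n * (η / (n + 1))) = η * (p n * middle n) := by
      field_simp
    linarith
  have huniv : (Finset.univ : Finset (Finset (Fin n))) =
      (Finset.univ.filter fun A => ¬ A.card + n / 4 ≤ n) ∪ M := by
    rw [Finset.union_comm, hMdef, Finset.filter_union_filter_not_eq]
  rw [huniv]
  refine (expMaxCard_union_le VeeFree.subset hpn (hp1 n) hl.le _ _).trans ?_
  refine (mul_le_mul_of_nonneg_left hall (Real.exp_pos _).le).trans ?_
  rw [← Real.exp_add, Real.exp_le_exp]
  have : p n * (Real.exp l - 1) * (((Finset.univ : Finset (Finset (Fin n))).filter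
      fun A => ¬ A.card + n / 4 ≤ n).card : ℝ) ≤ p n * (Real.exp l - 1) * (η * middle n) := by
    gcongr
  linarith

/-- For small `l`, `exp l - 1` is `l` up to order `l ^ 2`; taking `l` a small multiple of `min ε 1`
leaves a positive slack `δ` in the exponent. -/
theorem exists_eventually_expMaxCard_le {p : ℕ → ℝ} (hp0 : ∀ n, 0 ≤ p n) (hp1 : ∀ n, p n ≤ 1)
    (hp : Tendsto (fun n : ℕ => p n * n) atTop atTop) (r : ℕ) {ε : ℝ} (hε : 0 < ε) :
    ∃ l > 0, ∃ δ > 0, ∀ᶠ n : ℕ in atTop,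
      expMaxCard (VeeFree r) (p n) l (Finset.univ : Finset (Finset (Fin n))) ≤
        Real.exp ((l * (1 + ε) - δ) * (p n * middle n)) := by
  set e := min ε 1
  have he0 : 0 < e := lt_min hε one_pos
  have he1 : e ≤ 1 := min_le_right _ _
  have heε : e ≤ ε := min_le_left _ _
  refine ⟨e / 8, by positivity, e ^ 2 / 32, by positivity, ?_⟩
  filter_upwards [eventually_expMaxCard_univ_le hp0 hp1 hp r (l := e / 8) (ε := e / 4)
    (η := e ^ 2 / 160) (by positivity) (by positivity) (by positivity)] with n hn
  refine hn.trans (Real.exp_le_exp.2 ?_)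
  have hpN : 0 ≤ p n * middle n := mul_nonneg (hp0 n) (middle_pos n).le
  refine mul_le_mul_of_nonneg_right ?_ hpN
  have h1 := (abs_le.1 (Real.abs_exp_sub_one_sub_id_le (x := e / 8)
    (by rw [abs_of_pos (by positivity)]; linarith))).2
  have h2 : Real.exp (e / 8) - 1 ≤ e / 8 * (1 + e / 8) := by linarith
  have h3 : e ^ 2 ≤ e := by nlinarith
  calc (Real.exp (e / 8) - 1) * (1 + e / 4 + e ^ 2 / 160) + 5 * (e ^ 2 / 160)
      ≤ e / 8 * (1 + e / 8) * (1 + e / 4 + e / 160) + 5 * (e ^ 2 / 160) := by gcongr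
    _ ≤ e / 8 * (1 + e) - e ^ 2 / 32 := by nlinarith
    _ ≤ e / 8 * (1 + ε) - e ^ 2 / 32 := by gcongr

theorem eventually_biasedSum_upper_tail {p : ℕ → ℝ} (hp0 : ∀ n, 0 ≤ p n) (hp1 : ∀ n, p n ≤ 1)
    (hp : Tendsto (fun n : ℕ => p n * n) atTop atTop) (r : ℕ) {ε : ℝ} (hε : 0 < ε) :
    ∃ l > 0, Tendsto (fun n : ℕ => biasedSum (p n) (Finset.univ : Finset (Finset (Fin n)))
      fun S => Real.exp (l * (maxCard (VeeFree r) S - (1 + ε) * (p n * middle n))))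
      atTop (nhds 0) := by
  obtain ⟨l, hl, δ, hδ, h⟩ := exists_eventually_expMaxCard_le hp0 hp1 hp r hε
  refine ⟨l, hl, squeeze_zero' (Eventually.of_forall fun n =>
    biasedSum_nonneg (hp0 n) (hp1 n) fun _ => (Real.exp_pos _).le) ?_
    (tendsto_exp_neg_mul_middle hp0 hp hδ)⟩
  filter_upwards [h] with n hn
  have h1 : biasedSum (p n) (Finset.univ : Finset (Finset (Fin n)))
      (fun S => Real.exp (l * (maxCard (VeeFree r) S - (1 + ε) * (p n * middle n)))) =
      Real.exp (-(l * (1 + ε) * (p n * middle n))) *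
        expMaxCard (VeeFree r) (p n) l (Finset.univ : Finset (Finset (Fin n))) := by
    rw [expMaxCard, ← biasedSum_const_mul]
    congr 1
    ext S
    rw [← Real.exp_add]
    ring_nf
  rw [h1]
  refine (mul_le_mul_of_nonneg_left hn (Real.exp_pos _).le).trans_eq ?_
  rw [← Real.exp_add]
  ring_nf

/-! ### Lower tail and conclusion. -/

/-- Lower tail of the size of the intersection with a large family. -/
theorem biasedSum_lower_tail {α : Type*} [DecidableEq α] [Fintype α] {p l c ε N : ℝ} (hp0 : 0 ≤ p)
    (hp1 : p ≤ 1) (hl0 : 0 < l) (hl1 : l ≤ 1) (hc : l * c ≤ ε / 4) (hN : 0 ≤ N)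
    (hε : 0 ≤ ε) (D : Finset α) (hD : (c - ε / 2) * N ≤ D.card) :
    biasedSum p Finset.univ (fun S => Real.exp (l * ((c - ε) * (p * N) - (S ∩ D).card))) ≤
      Real.exp (-(l * ε / 4 * (p * N))) := by
  have h1 : biasedSum p Finset.univ
      (fun S => Real.exp (l * ((c - ε) * (p * N) - (S ∩ D).card))) =
      Real.exp (l * (c - ε) * (p * N)) * (1 + p * (Real.exp (-l) - 1)) ^ D.card := by
    conv_rhs => rw [← Finset.univ_inter D]
    rw [← biasedSum_pow_card_inter, ← biasedSum_const_mul]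
    congr 1
    ext S
    rw [← Real.exp_nat_mul, ← Real.exp_add]
    ring_nf
  have h2 := (abs_le.1 (Real.abs_exp_sub_one_sub_id_le (x := -l)
    (by rwa [abs_neg, abs_of_pos hl0]))).2
  have h3 : 0 ≤ 1 + p * (Real.exp (-l) - 1) := by
    have := Real.exp_pos (-l)
    nlinarith
  have h4 : 1 + p * (Real.exp (-l) - 1) ≤ Real.exp (-(p * (l - l ^ 2))) := by
    have := Real.add_one_le_exp (-(p * (l - l ^ 2)))
    nlinarith
  have h5 : 0 ≤ l - l ^ 2 := by nlinarith
  have h6 : p * (l - l ^ 2) * ((c - ε / 2) * N) ≤ p * (l - l ^ 2) * D.card := by gcongr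
  have h7 : p * N * (l * (l * (c - ε / 2))) ≤ p * N * (l * (ε / 4)) := by
    have : l * (c - ε / 2) ≤ ε / 4 := by nlinarith [mul_nonneg hl0.le hε]
    gcongr
  rw [h1]
  calc Real.exp (l * (c - ε) * (p * N)) * (1 + p * (Real.exp (-l) - 1)) ^ D.card
      ≤ Real.exp (l * (c - ε) * (p * N)) * Real.exp (-(p * (l - l ^ 2))) ^ D.card := by gcongr
    _ = Real.exp (l * (c - ε) * (p * N) + D.card * (-(p * (l - l ^ 2)))) := by
        rw [← Real.exp_nat_mul, ← Real.exp_add]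
    _ ≤ Real.exp (-(l * ε / 4 * (p * N))) := by
        rw [Real.exp_le_exp]
        nlinarith

/-- The asymptotics follow from vanishing upper tails and from induced `P`-free families of the
right size. -/
theorem largestInducedFreeAsymp_of {P : Type} [PartialOrder P] [Nonempty P] {p : ℕ → unitInterval}
    (hp : Tendsto (fun n : ℕ => (p n : ℝ) * n) atTop atTop) {c : ℝ} (hc : 0 < c)
    (hupper : ∀ ε : ℝ, 0 < ε → ∃ f : ∀ n : ℕ, Finset (Finset (Fin n)) → ℝ,
      (∀ n S, 0 ≤ f n S) ∧
      (∀ (n : ℕ) (S : Finset (Finset (Fin n))), (c + ε) * ((p n : ℝ) * middle n) <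
        largestInducedFree P (S : Set (Finset (Fin n))) → 1 ≤ f n S) ∧
      Tendsto (fun n => biasedSum (p n) Finset.univ (f n)) atTop (nhds 0))
    (D : ∀ n : ℕ, Finset (Finset (Fin n)))
    (hD : ∀ n, ∀ F ⊆ D n, IsInducedFree P (F : Set (Finset (Fin n))))
    (hDcard : ∀ ε : ℝ, 0 < ε → ∀ᶠ n : ℕ in atTop, (c - ε) * middle n ≤ (D n).card) :
    LargestInducedFreeAsymp P p c := by
  intro ε hε
  have hp0 : ∀ n, (0 : ℝ) ≤ p n := fun n => (p n).2.1
  have hp1 : ∀ n, (p n : ℝ) ≤ 1 := fun n => (p n).2.2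
  obtain ⟨f, hf0, hf1, hf⟩ := hupper ε hε
  set e := min ε c
  have he0 : 0 < e := lt_min hε hc
  set l := min 1 (e / (4 * c))
  have hl0 : 0 < l := lt_min one_pos (by positivity)
  have hlc : l * c ≤ e / 4 := by
    calc l * c ≤ e / (4 * c) * c := by
          gcongr
          exact min_le_right _ _
      _ = e / 4 := by field_simp
  let g : ∀ n : ℕ, Finset (Finset (Fin n)) → ℝ := fun n S =>
    Real.exp (l * ((c - e) * (p n * middle n) - (S ∩ D n).card))
  have hg : Tendsto (fun n => biasedSum (p n) Finset.univ (g n)) atTop (nhds 0) := by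
    refine squeeze_zero' (Eventually.of_forall fun n =>
      biasedSum_nonneg (hp0 n) (hp1 n) fun _ => (Real.exp_pos _).le) ?_
      (tendsto_exp_neg_mul_middle hp0 hp (show 0 < l * e / 4 by positivity))
    filter_upwards [hDcard (e / 2) (by positivity)] with n hn
    exact biasedSum_lower_tail (hp0 n) (hp1 n) hl0 (min_le_left _ _) hlc (middle_pos n).le he0.le
      (D n) hn
  have hfg := hf.add hg
  rw [add_zero] at hfg
  have hlim : Tendsto (fun n : ℕ => 1 - (biasedSum (p n) Finset.univ (f n) +
      biasedSum (p n) Finset.univ (g n))) atTop (nhds 1) := by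
    simpa using hfg.const_sub 1
  have hprob : ∀ n, MeasureTheory.IsProbabilityMeasure (randomFamily n (p n)) := fun n => by
    unfold randomFamily
    infer_instance
  refine tendsto_of_tendsto_of_tendsto_of_le_of_le hlim tendsto_const_nhds (fun n => ?_)
    fun n => MeasureTheory.measureReal_le_one
  set A : Set (Set (Finset (Fin n))) :=
    {S | (c - ε) * ((p n : ℝ) * (n.choose (n / 2) : ℝ)) ≤ (largestInducedFree P S : ℝ) ∧
        (largestInducedFree P S : ℝ) ≤ (c + ε) * ((p n : ℝ) * (n.choose (n / 2) : ℝ))}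
  have h1 : (randomFamily n (p n)).real Aᶜ ≤
      biasedSum (p n) Finset.univ (f n) + biasedSum (p n) Finset.univ (g n) := by
    rw [← biasedSum_add]
    have hg0 : ∀ S, 0 ≤ g n S := fun S => (Real.exp_pos _).le
    refine randomFamily_real_le (p n) _ _ (fun S => add_nonneg (hf0 n S) (hg0 S)) fun S hS => ?_
    by_cases hS1 : (c + ε) * ((p n : ℝ) * middle n) <
        largestInducedFree P (S : Set (Finset (Fin n)))
    · linarith [hf1 n S hS1, hg0 S]
    · have hS2 : (largestInducedFree P (S : Set (Finset (Fin n))) : ℝ) <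
          (c - ε) * ((p n : ℝ) * middle n) := by
        by_contra! h
        exact hS ⟨h, not_lt.1 hS1⟩
      have h2 : ((S ∩ D n).card : ℝ) ≤ largestInducedFree P (S : Set (Finset (Fin n))) := by
        exact_mod_cast le_largestInducedFree Finset.inter_subset_left
          (hD n _ Finset.inter_subset_right)
      have h3 : (c - ε) * ((p n : ℝ) * middle n) ≤ (c - e) * ((p n : ℝ) * middle n) := by
        have := hp0 n
        have := (middle_pos n).le
        gcongr
        exact min_le_left _ _
      have h4 : 1 ≤ g n S := Real.one_le_exp (mul_nonneg hl0.le (by linarith))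
      linarith [hf0 n S]
  -- Subadditivity suffices, so measurability of `A` is not needed.
  have h2 : 1 ≤ (randomFamily n (p n)).real A + (randomFamily n (p n)).real Aᶜ := by
    have := MeasureTheory.measureReal_union_le (μ := randomFamily n (p n)) A Aᶜ
    rwa [Set.union_compl_self, MeasureTheory.probReal_univ] at this
  linarith

/-- The ratio of the two consecutive binomial coefficients is `(n - n / 2) / (n / 2 + 1)`, which
tends to one. -/
theorem eventually_choose_half_succ_ge {ε : ℝ} (hε : 0 < ε) :
    ∀ᶠ n : ℕ in atTop, (1 - ε) * middle n ≤ n.choose (n / 2 + 1) := by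
  filter_upwards [tendsto_natCast_atTop_atTop.eventually_ge_atTop (2 / ε)] with n hn
  have h1 : (n.choose (n / 2 + 1) : ℝ) * (n / 2 + 1 : ℕ) = middle n * (n - n / 2 : ℕ) := by
    unfold middle
    exact_mod_cast Nat.choose_succ_right_eq n (n / 2)
  have h2 : ((n / 2 + 1 : ℕ) : ℝ) ≤ (n - n / 2 : ℕ) + 1 := by
    exact_mod_cast (by omega : n / 2 + 1 ≤ n - n / 2 + 1)
  have h3 : (n : ℝ) ≤ 2 * (n / 2 + 1 : ℕ) := by exact_mod_cast (by omega : n ≤ 2 * (n / 2 + 1))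
  have h4 : 1 ≤ ε * (n / 2 + 1 : ℕ) := by
    rw [div_le_iff₀ hε] at hn
    nlinarith
  have h5 : (0 : ℝ) < (n / 2 + 1 : ℕ) := by positivity
  refine le_of_mul_le_mul_right ?_ h5
  rw [h1]
  calc (1 - ε) * middle n * (n / 2 + 1 : ℕ)
      = middle n * ((n / 2 + 1 : ℕ) - ε * (n / 2 + 1 : ℕ)) := by ring
    _ ≤ middle n * (n - n / 2 : ℕ) := by
        have := (middle_pos n).le
        gcongr
        linarith

theorem largestInducedFreeAsymp_veePoset {p : ℕ → unitInterval}
    (hp : Tendsto (fun n : ℕ => (p n : ℝ) * n) atTop atTop) (r : ℕ) :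
    LargestInducedFreeAsymp (VeePoset (r + 1)) p 1 := by
  refine largestInducedFreeAsymp_of hp one_pos (fun ε hε => ?_)
    (fun n => Finset.univ.powersetCard (n / 2)) (fun n F hF => ?_) fun ε hε => ?_
  · obtain ⟨l, hl, h⟩ := eventually_biasedSum_upper_tail (fun n => (p n).2.1) (fun n => (p n).2.2)
      hp r hε
    refine ⟨_, fun n S => (Real.exp_pos _).le, fun n S hS => ?_, h⟩
    have : (largestInducedFree (VeePoset (r + 1)) (S : Set (Finset (Fin n))) : ℝ) ≤
        maxCard (VeeFree r) S := by exact_mod_cast largestInducedFree_veePoset_le r S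
    exact Real.one_le_exp (mul_nonneg hl.le (by linarith))
  · exact isInducedFree_veePoset_of_level fun A hA => (Finset.mem_powersetCard.1 (hF hA)).2
  · refine Eventually.of_forall fun n => ?_
    rw [Finset.card_powersetCard, Finset.card_univ, Fintype.card_fin]
    change (1 - ε) * middle n ≤ middle n
    nlinarith [middle_pos n]

theorem largestInducedFreeAsymp_kPoset {p : ℕ → unitInterval}
    (hp : Tendsto (fun n : ℕ => (p n : ℝ) * n) atTop atTop) {s t : ℕ} (hs : 1 ≤ s) (ht : 1 ≤ t) :
    LargestInducedFreeAsymp (KPoset s t) p 2 := by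
  refine largestInducedFreeAsymp_of hp two_pos (fun ε hε => ?_)
    (fun n => Finset.univ.powersetCard (n / 2) ∪ Finset.univ.powersetCard (n / 2 + 1))
    (fun n F hF => ?_) fun ε hε => ?_
  · obtain ⟨l, hl, h⟩ := eventually_biasedSum_upper_tail (fun n => (p n).2.1) (fun n => (p n).2.2)
      hp (t - 1) (half_pos hε)
    obtain ⟨l', hl', h'⟩ := eventually_biasedSum_upper_tail (fun n => (p n).2.1)
      (fun n => (p n).2.2) hp (s - 1) (half_pos hε)
    let f : ∀ n : ℕ, Finset (Finset (Fin n)) → ℝ := fun n S =>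
      Real.exp (l * (maxCard (VeeFree (t - 1)) S - (1 + ε / 2) * (p n * middle n)))
    let f' : ∀ n : ℕ, Finset (Finset (Fin n)) → ℝ := fun n S =>
      Real.exp (l' * (maxCard (VeeFree (s - 1)) S - (1 + ε / 2) * (p n * middle n)))
    refine ⟨fun n S => f n S + f' n (S.map (complEquiv n).toEmbedding), fun n S => by positivity,
      fun n S hS => ?_, ?_⟩
    · have h1 : (largestInducedFree (KPoset s t) (S : Set (Finset (Fin n))) : ℝ) ≤
          maxCard (VeeFree (t - 1)) S +
            maxCard (VeeFree (s - 1)) (S.map (complEquiv n).toEmbedding) := by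
        exact_mod_cast largestInducedFree_kPoset_le hs t S
      have hf0 : 0 < f n S := Real.exp_pos _
      have hf0' : 0 < f' n (S.map (complEquiv n).toEmbedding) := Real.exp_pos _
      -- If the two maxima sum to more than `(2 + ε) * (p n * middle n)`, one of them is at least
      -- half of that.
      by_cases h2 : (1 + ε / 2) * ((p n : ℝ) * middle n) ≤ maxCard (VeeFree (t - 1)) S
      · have : 1 ≤ f n S := Real.one_le_exp (mul_nonneg hl.le (by linarith))
        linarith
      · have : 1 ≤ f' n (S.map (complEquiv n).toEmbedding) :=
          Real.one_le_exp (mul_nonneg hl'.le (by linarith))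
        linarith
    · simp only [biasedSum_add, biasedSum_map_equiv]
      simpa using h.add h'
  · refine isInducedFree_kPoset_of_levels hs ht (j := n / 2) fun A hA => ?_
    rcases Finset.mem_union.1 (hF hA) with h | h
    · exact Or.inl (Finset.mem_powersetCard.1 h).2
    · exact Or.inr (Finset.mem_powersetCard.1 h).2
  · filter_upwards [eventually_choose_half_succ_ge hε] with n hn
    rw [Finset.card_union_of_disjoint (Finset.disjoint_left.2 fun A hA hA' => by
      have h1 := (Finset.mem_powersetCard.1 hA).2
      have h2 := (Finset.mem_powersetCard.1 hA').2
      omega), Finset.card_powersetCard, Finset.card_powersetCard, Finset.card_univ,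
      Fintype.card_fin, Nat.cast_add]
    change (2 - ε) * middle n ≤ middle n + _
    linarith

theorem mainTheorem2 (p : ℕ → unitInterval)
    (hp : (fun n : ℕ => 1 / (n : ℝ)) =o[atTop] fun n : ℕ => (p n : ℝ)) :
    (∀ r : ℕ, LargestInducedFreeAsymp (VeePoset (r + 1)) p 1) ∧
    (∀ s t : ℕ, 1 ≤ s → 1 ≤ t → LargestInducedFreeAsymp (KPoset s t) p 2) := by
  have h := tendsto_mul_natCast_atTop (fun n => (p n).2.1) hp
  exact ⟨fun r => largestInducedFreeAsymp_veePoset h r,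
    fun s t hs ht => largestInducedFreeAsymp_kPoset h hs ht⟩
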